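/- Let $V$ be a finite set and let $G$ be a graph with node set $V$, without loops, with at most one edge between any two nodes, where each edge is undirected ($a - b$), solid directed ($a \rightarrow b$) or dashed directed ($a \dashrightarrow b$). Write $a \multimap b$ if $a \rightarrow b$, $a \dashrightarrow b$ or $a - b$ is in $G$. For $X \subseteq V$ let $Fa(X)=\{a : a \rightarrow b \text{ for some } b\in X\}$, $Mo(X)=\{a : a \dashrightarrow b \text{ for some } b\in X\}$, $Pa(X)=Fa(X)\cup Mo(X)$, $Ne(X)=\{a : a - b \text{ for some } b\in X\}$, and let $Nd(X)$ be the set of nodes $b$ for which there is no sequence $a = v_1 \multimap v_2 \multimap \cdots \multimap v_n = b$ with $a\in X$ that uses at least one directed edge. For a single node $i$ write $Fa(i)=Fa(\{i\})$, etc. A set of nodes is connected if any two of its nodes are joined by a sequence of undirected edges of $G$; the chain components of $G$ are its maximal connected sets, and $Cc(G)$ is the set of them. $G$ is a unified chain graph (UCG) if it has no semidirected cycle, i.e. no $v_1 \multimap v_2 \multimap \cdots \multimap v_n = v_1$ whose first edge is directed, and $Fa(K)\cap Mo(K)=\emptyset$ for all $K\in Cc(G)$. A route is a sequence of not necessarily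 distinct nodes in which consecutive nodes are adjacent. An (occurrence of a) node $C$ in a route is a collider node if the route, read in one of its two directions, passes through it as $A \dashrightarrow C \dashleftarrow B$, $A \dashrightarrow C - B$ or $A \dashrightarrow C \leftarrow B$. A collider section of a route is a part $C_1 - \cdots - C_n$ ($n\ge 1$) of it that the route passes through as $A \rightarrow C_1 - \cdots - C_n \leftarrow B$. For $Z\subseteq V$, a route is $Z$-open if (i) all its collider nodes are in $Z$, (ii) each of its collider sections has some node in $Z$, and (iii) all its other node occurrences (neither collider nodes nor in a collider section) are outside $Z$. For pairwise disjoint $X,Y,Z\subseteq V$, $X$ is separated from $Y$ given $Z$ in $G$ if there is no $Z$-open route between a node in $X$ and a node in $Y$. Let $p$ be a probability distribution on $\mathbb{R}^V$, and write $X\perp_p Y\mid Z$ if, under $p$, the coordinates in $X$ are conditionally independent of those in $Y$ given those in $Z$. (Set operations have equal precedence and are evaluated from left to right, unless parentheses are used to indicate a different order; singletons may be written without braces.) One says that $p$ satisfies, with respect to a UCG $G$, * the **global Markov property** if $X\perp_p Y\mid Z$ for all pairwise disjoint $X,Y,Z\subseteq V$ such that $X$ is separated from $Y$ given $Z$ in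 $G$; * the **block-recursive Markov property** if for all $K\in Cc(G)$ and $i\in K$: (B1) $i\perp_p Nd(K)\setminus K\setminus Fa(K)\setminus Mo(i)\mid Fa(K)\cup Mo(i)$, (B2) $i\perp_p Nd(K)\setminus K\setminus Fa(i)\setminus Mo(K)\mid K\setminus\{i\}\cup Fa(i)\cup Mo(K)$, (B3) $i\perp_p j\mid K\setminus\{i,j\}\cup Pa(K)$ for all $j\in K\setminus\{i\}\setminus Ne(i)$; * the **pairwise Markov property** if for all non-adjacent nodes $i,j$, with $i\in K\in Cc(G)$: (P1) $i\perp_p j\mid Nd(i)\setminus K\setminus\{j\}$ if $j\in Nd(i)\setminus K\setminus Fa(K)\setminus Mo(i)$, (P2) $i\perp_p j\mid Nd(i)\setminus\{i,j\}$ if $j\in Nd(i)\setminus\{i\}\setminus Fa(i)\setminus Mo(K)$; * the **local Markov property** if for all nodes $i$, with $i\in K\in Cc(G)$: (L1) $i\perp_p Nd(i)\setminus K\setminus Fa(K)\setminus Mo(i)\mid Fa(K)\cup Mo(i)$, (L2) $i\perp_p Nd(i)\setminus\{i\}\setminus Pa(i)\setminus Ne(i)\setminus Mo(Ne(i))\mid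 Pa(i)\cup Ne(i)\cup Mo(Ne(i))$. **Corollary.** Let $G$ be a UCG over $V$ and let $p$ be a Gaussian distribution on $\mathbb{R}^V$ with positive definite covariance matrix. Then the global, block-recursive, local and pairwise Markov properties of $p$ with respect to $G$ are all equivalent. -/

import Mathlib

open MeasureTheory ProbabilityTheory

/-- A graph with undirected edges (`line`), solid directed edges (`solid a b` is
`a → b`) and dashed directed edges (`dashed a b` is the dashed arrow from `a` to `b`), having no
loops and at most one edge between any two nodes. -/
structure MixedGraph (V : Type*) where
  line : V → V → Prop
  solid : V → V → Prop
  dashed : V → V → Prop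
  line_symm : ∀ a b, line a b → line b a
  line_irrefl : ∀ a, ¬ line a a
  not_line_solid : ∀ a b, ¬ (line a b ∧ solid a b)
  not_line_dashed : ∀ a b, ¬ (line a b ∧ dashed a b)
  not_solid_solid : ∀ a b, ¬ (solid a b ∧ solid b a)
  not_dashed_dashed : ∀ a b, ¬ (dashed a b ∧ dashed b a)
  not_solid_dashed : ∀ a b, ¬ (solid a b ∧ dashed a b)
  not_solid_dashed_rev : ∀ a b, ¬ (solid a b ∧ dashed b a)

namespace MixedGraph

variable {V : Type*} (G : MixedGraph V)

/-- There is a directed edge (solid or dashed) from `a` to `b`. -/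
def Arrow (a b : V) : Prop := G.solid a b ∨ G.dashed a b

/-- There is an edge `a → b`, a dashed edge from `a` to `b`, or an edge `a - b`. -/
def Step (a b : V) : Prop := G.Arrow a b ∨ G.line a b

/-- The fathers of a set of nodes. -/
def Fa (X : Set V) : Set V := {a | ∃ b ∈ X, G.solid a b}

/-- The mothers of a set of nodes. -/
def Mo (X : Set V) : Set V := {a | ∃ b ∈ X, G.dashed a b}

/-- The parents of a set of nodes. -/
def Pa (X : Set V) : Set V := {a | ∃ b ∈ X, G.solid a b ∨ G.dashed a b}

/-- The neighbors of a set of nodes. -/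
def Ne (X : Set V) : Set V := {a | ∃ b ∈ X, G.line a b}

/-- The non-descendants of `X`: the nodes `b` such that no route `a ⊸ ⋯ ⊸ b` with `a ∈ X`, all of
whose edges are undirected or point towards `b`, contains a directed edge. -/
def Nd (X : Set V) : Set V :=
  {b | ¬ ∃ a ∈ X, ∃ c d, Relation.ReflTransGen G.Step a c ∧ G.Arrow c d ∧
    Relation.ReflTransGen G.Step d b}

/-- No semidirected cycle: no cycle that starts with a directed edge and continues along edges
that are undirected or point forwards. -/
def IsChainGraph : Prop := ∀ a b, G.Arrow a b → ¬ Relation.ReflTransGen G.Step b a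

/-- Every two nodes of `S` are joined by an undirected route. -/
def IsConnectedSet (S : Set V) : Prop :=
  ∀ a ∈ S, ∀ b ∈ S, Relation.ReflTransGen G.line a b

/-- The chain components: the maximal connected sets. -/
def Cc : Set (Set V) := {K | Maximal G.IsConnectedSet K}

/-- Unified chain graphs. -/
structure IsUCG : Prop where
  isChainGraph : G.IsChainGraph
  disjoint_Fa_Mo : ∀ K ∈ G.Cc, Disjoint (G.Fa K) (G.Mo K)

/-- The underlying simple graph. Its walks are the routes of `G`: sequences of not necessarily
distinct nodes in which consecutive nodes are adjacent (the edge between them is unique). -/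
def skeleton : SimpleGraph V where
  Adj a b := G.Step a b ∨ G.Step b a
  symm := ⟨fun _ _ h => h.symm⟩
  loopless := ⟨fun a h => by
    have h' : G.Step a a := h.elim id id
    rcases h' with (h | h) | h
    · exact G.not_solid_solid a a ⟨h, h⟩
    · exact G.not_dashed_dashed a a ⟨h, h⟩
    · exact G.line_irrefl a h⟩

variable {G} in
/-- The occurrence at position `k` of the route `ρ` is a collider node: it is an intermediate
occurrence `C` in which `ρ`, read in one of the two directions, has a dashed edge from `A` to `C`
followed by a dashed edge from `B` to `C`, an edge `C - B`, or an edge `B → C`. -/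
def IsColliderNode {a b : V} (ρ : G.skeleton.Walk a b) (k : ℕ) : Prop :=
  0 < k ∧ k < ρ.length ∧
    ((G.dashed (ρ.getVert (k - 1)) (ρ.getVert k) ∧
        (G.dashed (ρ.getVert (k + 1)) (ρ.getVert k) ∨ G.line (ρ.getVert k) (ρ.getVert (k + 1)) ∨
          G.solid (ρ.getVert (k + 1)) (ρ.getVert k))) ∨
      (G.dashed (ρ.getVert (k + 1)) (ρ.getVert k) ∧
        (G.dashed (ρ.getVert (k - 1)) (ρ.getVert k) ∨ G.line (ρ.getVert k) (ρ.getVert (k - 1)) ∨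
          G.solid (ρ.getVert (k - 1)) (ρ.getVert k))))

variable {G} in
/-- The positions `s, …, t` of the route `ρ` form a collider section
`A → C₁ - ⋯ - Cₙ ← B`, with `n ≥ 1` (it is a maximal undirected subroute, as it is flanked by
directed edges). -/
def IsColliderSection {a b : V} (ρ : G.skeleton.Walk a b) (s t : ℕ) : Prop :=
  0 < s ∧ s ≤ t ∧ t < ρ.length ∧
    G.solid (ρ.getVert (s - 1)) (ρ.getVert s) ∧
    (∀ k, s ≤ k → k < t → G.line (ρ.getVert k) (ρ.getVert (k + 1))) ∧
    G.solid (ρ.getVert (t + 1)) (ρ.getVert t)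

variable {G} in
/-- The route `ρ` is `Z`-open. -/
structure IsOpenRoute (Z : Set V) {a b : V} (ρ : G.skeleton.Walk a b) : Prop where
  collider_node : ∀ k, IsColliderNode ρ k → ρ.getVert k ∈ Z
  collider_section : ∀ s t, IsColliderSection ρ s t → ∃ k, s ≤ k ∧ k ≤ t ∧ ρ.getVert k ∈ Z
  other : ∀ k ≤ ρ.length, ¬ IsColliderNode ρ k →
    (¬ ∃ s t, IsColliderSection ρ s t ∧ s ≤ k ∧ k ≤ t) → ρ.getVert k ∉ Z

/-- `X` is separated from `Y` given `Z` in `G`. -/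
def Separated (X Y Z : Set V) : Prop :=
  ∀ a ∈ X, ∀ b ∈ Y, ∀ ρ : G.skeleton.Walk a b, ¬ IsOpenRoute Z ρ

end MixedGraph

/-- The coordinates indexed by `X` and those indexed by `Y` are conditionally independent given
those indexed by `Z`, under the distribution `p` of a random vector indexed by `V`. -/
def CondIndepCoords {V : Type*} [Fintype V] (p : Measure (V → ℝ)) [IsFiniteMeasure p]
    (X Y Z : Set V) : Prop :=
  CondIndepFun (MeasurableSpace.comap (fun (x : V → ℝ) (v : Z) => x v) inferInstance)
    (Measurable.comap_le (measurable_pi_lambda _ fun _ => measurable_pi_apply _))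
    (fun (x : V → ℝ) (v : X) => x v) (fun (x : V → ℝ) (v : Y) => x v) p

/-- The covariance matrix of a distribution of a random vector indexed by `V`. -/
noncomputable def covMatrix {V : Type*} (p : Measure (V → ℝ)) : Matrix V V ℝ :=
  Matrix.of fun i j => covariance (fun x => x i) (fun x => x j) p

namespace MixedGraph

variable {V : Type*} [Fintype V] (G : MixedGraph V) (p : Measure (V → ℝ)) [IsFiniteMeasure p]

/-- The global Markov property. -/
def GlobalMarkov : Prop :=
  ∀ X Y Z : Set V, Disjoint X Y → Disjoint X Z → Disjoint Y Z →
    G.Separated X Y Z → CondIndepCoords p X Y Z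

/-- The block-recursive Markov property (B1)-(B3). -/
def BlockRecursiveMarkov : Prop :=
  ∀ K ∈ G.Cc, ∀ i ∈ K,
    CondIndepCoords p {i} (((G.Nd K \ K) \ G.Fa K) \ G.Mo {i}) (G.Fa K ∪ G.Mo {i}) ∧
    CondIndepCoords p {i} (((G.Nd K \ K) \ G.Fa {i}) \ G.Mo K)
      (((K \ {i}) ∪ G.Fa {i}) ∪ G.Mo K) ∧
    ∀ j ∈ (K \ {i}) \ G.Ne {i}, CondIndepCoords p {i} {j} ((K \ {i, j}) ∪ G.Pa K)

/-- The pairwise Markov property (P1)-(P2). -/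
def PairwiseMarkov : Prop :=
  ∀ K ∈ G.Cc, ∀ i ∈ K, ∀ j, ¬ G.skeleton.Adj i j →
    (j ∈ ((G.Nd {i} \ K) \ G.Fa K) \ G.Mo {i} →
      CondIndepCoords p {i} {j} ((G.Nd {i} \ K) \ {j})) ∧
    (j ∈ ((G.Nd {i} \ {i}) \ G.Fa {i}) \ G.Mo K →
      CondIndepCoords p {i} {j} (G.Nd {i} \ {i, j}))

/-- The local Markov property (L1)-(L2). -/
def LocalMarkov : Prop :=
  ∀ K ∈ G.Cc, ∀ i ∈ K,
    CondIndepCoords p {i} (((G.Nd {i} \ K) \ G.Fa K) \ G.Mo {i}) (G.Fa K ∪ G.Mo {i}) ∧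
    CondIndepCoords p {i}
      ((((G.Nd {i} \ {i}) \ G.Pa {i}) \ G.Ne {i}) \ G.Mo (G.Ne {i}))
      ((G.Pa {i} ∪ G.Ne {i}) ∪ G.Mo (G.Ne {i}))

end MixedGraph

/-!
For a Gaussian distribution with regular covariance matrix, `i ⊥ T ∣ S` says that the residual of
the regression of `i` on `S` is orthogonal to `T`, and hence that the regression of `i` on `S ∪ T`
has zero coefficients on `T \ S`. In this way the pairwise, the local and the block-recursive
property all prescribe the same zeros in two regressions of each node: on the nodes that precede its
chain component, and on all its other non-descendants.

These zeros make the precision matrix factor as `(1 - B - F)ᵀ W (1 - B - F)`, where `B` is supported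
on the dashed edges, `F` on the solid edges composed with undirected routes, and `W` is block
diagonal over the chain components, with its zeros and those of `W F` given by the undirected and by
the solid edges. To see that this implies the global property, let `γ` be the coefficient vector of
the residual of `a` after regression on `Z` and `b`. If no open route joins `a` and `b`, the part of
the graph that open routes from `a` can reach splits the vector `(1 - B - F) γ` in two pieces such
that the one on the side of `b` is orthogonal to itself with respect to `W`. As `W` is positive
definite, that piece vanishes, and with it the coefficient of `b`.

Conversely, the separations that the pairwise property asks for can be read off the first and last
arrows of a route.
-/

open scoped Matrix

/-! ### Gaussian conditional independence and linear regression -/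

section ConditionalIndependence

variable {Ω β γ δ : Type*} {mΩ : MeasurableSpace Ω} {mβ : MeasurableSpace β}
  {mγ : MeasurableSpace γ} {mδ : MeasurableSpace δ}

lemma condDistrib_of_indepFun [StandardBorelSpace δ] [Nonempty δ] {μ : Measure Ω}
    [IsProbabilityMeasure μ] {W : Ω → β} {R : Ω → γ} (hW : Measurable W) (hR : Measurable R)
    (hind : IndepFun W R μ) {φ : β × γ → δ} (hφ : Measurable φ) :
    condDistrib (fun ω => φ (W ω, R ω)) W μ =ᵐ[μ.map W]
      (Kernel.id ×ₖ Kernel.const β (μ.map R)).map φ := by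
  have : IsProbabilityMeasure (μ.map R) := Measure.isProbabilityMeasure_map hR.aemeasurable
  have : IsProbabilityMeasure (μ.map W) := Measure.isProbabilityMeasure_map hW.aemeasurable
  refine condDistrib_ae_eq_of_measure_eq_compProd W (by fun_prop) ?_
  have hlaw : μ.map (fun ω => (W ω, φ (W ω, R ω))) =
      ((μ.map W).prod (μ.map R)).map (fun q => (q.1, φ q)) := by
    rw [← (indepFun_iff_map_prod_eq_prod_map_map hW.aemeasurable hR.aemeasurable).1 hind,
      Measure.map_map (by fun_prop) (by fun_prop)]
    rfl
  rw [hlaw]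
  ext s hs
  rw [Measure.map_apply (by fun_prop) hs, Measure.compProd_apply hs,
    Measure.prod_apply ((by fun_prop : Measurable fun q : β × γ => (q.1, φ q)) hs)]
  refine lintegral_congr fun w => ?_
  have hsec : MeasurableSet (Prod.mk w ⁻¹' s) := measurable_prodMk_left hs
  rw [Kernel.map_apply' _ hφ _ hsec, Kernel.prod_apply, Kernel.id_apply, Kernel.const_apply,
    Measure.prod_apply (hφ hsec), lintegral_dirac' _ (measurable_measure_prodMk_left (hφ hsec))]
  rfl

lemma condIndepFun_of_indepFun_prodMk [StandardBorelSpace Ω] [StandardBorelSpace β] [Nonempty β]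
    [StandardBorelSpace δ] [Nonempty δ] {ε : Type*} {mε : MeasurableSpace ε} {μ : Measure Ω}
    [IsProbabilityMeasure μ] {k : Ω → γ} {Y : Ω → β} {R : Ω → ε} (hk : Measurable k)
    (hY : Measurable Y) (hR : Measurable R) (hind : IndepFun (fun ω => (k ω, Y ω)) R μ)
    {φ : γ × ε → δ} (hφ : Measurable φ) :
    (fun ω => φ (k ω, R ω)) ⟂ᵢ[k, hk; μ] Y := by
  refine CondIndepFun.symm ?_
  rw [condIndepFun_iff_condDistrib_prod_ae_eq_prodMkRight (by fun_prop) hY hk]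
  have given_kY := condDistrib_of_indepFun (hk.prodMk hY) hR hind
    (φ := fun q : (γ × β) × ε => φ (q.1.1, q.2)) (by fun_prop)
  have given_k := condDistrib_of_indepFun hk hR (hind.comp measurable_fst measurable_id) hφ
  rw [show μ.map k = (μ.map fun ω => (k ω, Y ω)).map Prod.fst by
    rw [Measure.map_map measurable_fst (by fun_prop)]; rfl] at given_k
  filter_upwards [given_kY, ae_of_ae_map measurable_fst.aemeasurable given_k] with q h₁ h₂
  have : IsProbabilityMeasure (μ.map R) := Measure.isProbabilityMeasure_map hR.aemeasurable
  refine h₁.trans ?_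
  rw [Kernel.prodMkRight_apply, h₂, Kernel.map_apply _ hφ, Kernel.map_apply _ (by fun_prop),
    Kernel.prod_apply, Kernel.prod_apply, Kernel.id_apply, Kernel.const_apply, Kernel.id_apply,
    Kernel.const_apply, Measure.dirac_prod, Measure.dirac_prod,
    Measure.map_map (by fun_prop) (by fun_prop), Measure.map_map hφ (by fun_prop)]
  rfl

end ConditionalIndependence

section ConditionalExpectation

variable {Ω : Type*} {m mΩ : MeasurableSpace Ω} [StandardBorelSpace Ω] {hm : m ≤ mΩ}
  {μ : Measure Ω} {f g l : Ω → ℝ}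

lemma condExp_mul_of_condIndepFun [IsFiniteMeasure μ] (h : CondIndepFun m hm f g μ)
    (hf : Measurable f) (hg : Measurable g) (hf_int : Integrable f μ) (hg_int : Integrable g μ)
    (hfg_int : Integrable (f * g) μ) : μ[f * g | m] =ᵐ[μ] μ[f | m] * μ[g | m] := by
  have hker := ae_of_ae_trim hm ((condIndepFun_iff_map_prod_eq_prod_map_map hf hg).1 h)
  filter_upwards [hker, condExp_ae_eq_integral_condExpKernel hm hf_int,
    condExp_ae_eq_integral_condExpKernel hm hg_int,
    condExp_ae_eq_integral_condExpKernel hm hfg_int] with ω hω ef eg efg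
  rw [Kernel.map_apply _ (hf.prodMk hg), Kernel.prod_apply, Kernel.map_apply _ hf,
    Kernel.map_apply _ hg] at hω
  have hind : IndepFun f g (condExpKernel μ m ω) :=
    (indepFun_iff_map_prod_eq_prod_map_map hf.aemeasurable hg.aemeasurable).2 hω
  rw [Pi.mul_apply, ef, eg, efg]
  exact hind.integral_mul_eq_mul_integral hf.aestronglyMeasurable hg.aestronglyMeasurable

lemma covariance_add_eq_zero_of_condIndepFun [IsProbabilityMeasure μ]
    (h : CondIndepFun m hm f g μ) (hf : Measurable f) (hg : Measurable g) (hf₂ : MemLp f 2 μ)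
    (hg₂ : MemLp g 2 μ) (hl₂ : MemLp l 2 μ) (hl : StronglyMeasurable[m] l)
    (hconst : μ[f + l | m] =ᵐ[μ] fun _ => μ[f + l]) : covariance (f + l) g μ = 0 := by
  have hf₁ := hf₂.integrable one_le_two
  have hg₁ := hg₂.integrable one_le_two
  have hl₁ := hl₂.integrable one_le_two
  have hfg := hf₂.integrable_mul hg₂
  have hlg := hl₂.integrable_mul hg₂
  have factor : μ[(f + l) * g | m] =ᵐ[μ] fun ω => μ[f + l] * (μ[g | m]) ω := by
    rw [add_mul]
    filter_upwards [condExp_add hfg hlg m, condExp_mul_of_condIndepFun h hf hg hf₁ hg₁ hfg,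
      condExp_mul_of_stronglyMeasurable_left hl hlg hg₁, condExp_add hf₁ hl₁ m, hconst]
      with ω e₁ e₂ e₃ e₄ e₅
    rw [e₁, Pi.add_apply, e₂, e₃, Pi.mul_apply, Pi.mul_apply, ← add_mul, ← e₅, e₄, Pi.add_apply,
      condExp_of_stronglyMeasurable hm hl hl₁]
  rw [covariance_eq_sub (hf₂.add hl₂) hg₂, sub_eq_zero, ← integral_condExp hm,
    integral_congr_ae factor, integral_const_mul, integral_condExp hm]

end ConditionalExpectation

section Gaussian

variable {V : Type*}

lemma memLp_two_coord [Finite V] (p : Measure (V → ℝ)) [IsGaussian p] (i : V) :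
    MemLp (fun x : V → ℝ => x i) 2 p := by
  have := Fintype.ofFinite V
  exact ((IsGaussian.hasGaussianLaw_id (μ := p)).map
    (ContinuousLinearMap.proj (R := ℝ) (φ := fun _ : V => ℝ) i)).memLp_two

variable [Fintype V]

lemma exists_measurable_dotProduct_eq_domRestrict {S : Set V} {c : V → ℝ}
    (hc : ∀ j ∉ S, c j = 0) :
    ∃ f : (S → ℝ) → ℝ, Measurable f ∧ ∀ x : V → ℝ, c ⬝ᵥ x = f (S.domRestrict x) := by
  classical
  refine ⟨fun y => ∑ j : S, c j * y j, by fun_prop, fun x => ?_⟩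
  simp only [dotProduct, Set.domRestrict_apply]
  rw [← Finset.sum_subtype (Finset.univ.filter (· ∈ S)) (by simp) fun j => c j * x j]
  refine (Finset.sum_filter_of_ne fun j _ hj => ?_).symm
  exact not_imp_comm.1 (hc j) (left_ne_zero_of_mul hj)

section Moments

variable (p : Measure (V → ℝ)) [IsGaussian p]

lemma memLp_two_dotProduct (g : V → ℝ) : MemLp (fun x : V → ℝ => g ⬝ᵥ x) 2 p := by
  simp only [dotProduct]
  exact memLp_finsetSum _ fun i _ => (memLp_two_coord p i).const_mul (g i)

lemma covariance_dotProduct_coord (g : V → ℝ) (b : V) :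
    covariance (fun x => g ⬝ᵥ x) (fun x => x b) p = (covMatrix p *ᵥ g) b := by
  simp only [dotProduct, Matrix.mulVec, covMatrix, Matrix.of_apply]
  rw [covariance_fun_sum_left (fun i => (memLp_two_coord p i).const_mul (g i))
    (memLp_two_coord p b)]
  refine Finset.sum_congr rfl fun i _ => ?_
  rw [covariance_const_mul_left, covariance_comm, mul_comm]

lemma indepFun_dotProduct_domRestrict {ι : Type*} [Finite ι] {S : Set V} {g : ι → V → ℝ}
    (h : ∀ i, ∀ s ∈ S, (covMatrix p *ᵥ g i) s = 0) :
    IndepFun (fun (x : V → ℝ) i => g i ⬝ᵥ x) S.domRestrict p := by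
  classical
  refine HasGaussianLaw.indepFun_of_covariance_eval (Y := fun (s : S) (x : V → ℝ) => x s) ?_
    fun i s => ?_
  · have := Fintype.ofFinite ι
    let L₁ : (V → ℝ) →L[ℝ] (ι → ℝ) := ContinuousLinearMap.pi fun i =>
      ∑ v, g i v • ContinuousLinearMap.proj (R := ℝ) (φ := fun _ : V => ℝ) v
    let L₂ : (V → ℝ) →L[ℝ] (S → ℝ) := ContinuousLinearMap.pi fun s =>
      ContinuousLinearMap.proj (R := ℝ) (φ := fun _ : V => ℝ) (s : V)
    have hL : (fun x : V → ℝ => (fun i => g i ⬝ᵥ x, fun s : S => x s)) = L₁.prod L₂ ∘ id := by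
      ext x a <;> simp [L₁, L₂, dotProduct]
    rw [hL]
    exact IsGaussian.hasGaussianLaw_id.map (L₁.prod L₂)
  · rw [covariance_dotProduct_coord]
    exact h i s s.2

end Moments

/-- Population linear regression of the coordinate `a` on the coordinates in `S`, for a random
vector with covariance matrix `A`: `g` is the coefficient vector of the residual, so that `-g j`,
for `j ∈ S`, are the regression coefficients. -/
structure IsResidual (A : Matrix V V ℝ) (S : Set V) (a : V) (g : V → ℝ) : Prop where
  self : g a = 1
  zero : ∀ j, j ∉ S → j ≠ a → g j = 0
  orth : ∀ s ∈ S, (A *ᵥ g) s = 0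

namespace IsResidual

variable {A : Matrix V V ℝ} {S T : Set V} {a : V} {g : V → ℝ}

lemma sub_single_apply_eq_zero [DecidableEq V] (hg : IsResidual A S a g) {j : V} (hj : j ∉ S) :
    (g - Pi.single a 1 : V → ℝ) j = 0 := by
  rcases eq_or_ne j a with rfl | hja
  · simp [hg.self]
  · simp [hg.zero j hj hja, hja]

lemma mono (hST : S ⊆ T) (hg : IsResidual A S a g) (h : ∀ j ∈ T \ S, (A *ᵥ g) j = 0) :
    IsResidual A T a g where
  self := hg.self
  zero j hj := hg.zero j (mt (@hST j) hj)
  orth j hj := by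
    by_cases hS : j ∈ S
    · exact hg.orth j hS
    · exact h j ⟨hj, hS⟩

lemma anti (hST : S ⊆ T) (hg : IsResidual A T a g) (h : ∀ j ∈ T \ S, g j = 0) :
    IsResidual A S a g where
  self := hg.self
  zero j hj hja := by
    by_cases hT : j ∈ T
    · exact h j ⟨hT, hj⟩
    · exact hg.zero j hT hja
  orth j hj := hg.orth j (hST hj)

end IsResidual

section Residual

variable {p : Measure (V → ℝ)} [IsGaussian p] {X Y Z : Set V}

lemma condIndepCoords_of_isResidual
    (h : ∀ a ∈ X, ∃ g, IsResidual (covMatrix p) Z a g ∧ ∀ b ∈ Y, (covMatrix p *ᵥ g) b = 0) :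
    CondIndepCoords p X Y Z := by
  classical
  choose! g hg hgY using h
  have hpred (a : X) := exists_measurable_dotProduct_eq_domRestrict
    fun j hj => (hg a a.2).sub_single_apply_eq_zero (j := j) hj
  choose f hf hfeq using hpred
  let R : (V → ℝ) → (X → ℝ) := fun x a => g a ⬝ᵥ x
  have hR : Measurable R := by
    refine measurable_pi_lambda _ fun a => ?_
    simp only [R, dotProduct]
    fun_prop
  have hX : (fun (x : V → ℝ) (a : X) => x a) = fun x a => R x a - f a (Z.domRestrict x) := by
    ext x a
    simp only [R, ← hfeq, sub_dotProduct, single_dotProduct, one_mul, sub_sub_cancel]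
  have hind : IndepFun (fun x : V → ℝ => (Z.domRestrict x, Y.domRestrict x)) R p := by
    have hZY : IndepFun R (Z ∪ Y).domRestrict p := indepFun_dotProduct_domRestrict p fun a s hs =>
      hs.elim ((hg a a.2).orth s) (hgY a a.2 s)
    exact (hZY.comp measurable_id (ψ := fun y : ↥(Z ∪ Y) → ℝ =>
      ((fun z : Z => y ⟨z, .inl z.2⟩, fun z : Y => y ⟨z, .inr z.2⟩) : (Z → ℝ) × (Y → ℝ)))
      (by fun_prop)).symm
  unfold CondIndepCoords
  rw [hX]
  exact condIndepFun_of_indepFun_prodMk (φ := fun q a => q.2 a - f a q.1)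
    Z.measurable_restrict Y.measurable_restrict hR hind (by fun_prop)

lemma CondIndepCoords.mulVec_eq_zero (h : CondIndepCoords p X Y Z) {a b : V} (ha : a ∈ X)
    (hb : b ∈ Y) {g : V → ℝ} (hg : IsResidual (covMatrix p) Z a g) :
    (covMatrix p *ᵥ g) b = 0 := by
  classical
  let l : (V → ℝ) → ℝ := fun x => (g - Pi.single a 1) ⬝ᵥ x
  have hsum : (fun x : V → ℝ => x a) + l = fun x => g ⬝ᵥ x := by
    ext x
    simp [l, sub_dotProduct]
  obtain ⟨f, hf, hlf⟩ := exists_measurable_dotProduct_eq_domRestrict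
    fun j hj => hg.sub_single_apply_eq_zero (j := j) hj
  have hl : StronglyMeasurable[MeasurableSpace.comap Z.domRestrict inferInstance] l := by
    rw [show l = f ∘ Z.domRestrict from funext hlf]
    exact (hf.comp (comap_measurable _)).stronglyMeasurable
  have hab : CondIndepFun _ _ (fun x : V → ℝ => x a) (fun x : V → ℝ => x b) p :=
    CondIndepFun.comp h (measurable_pi_apply ⟨a, ha⟩) (measurable_pi_apply ⟨b, hb⟩)
  have hind : IndepFun (fun x => g ⬝ᵥ x) Z.domRestrict p :=
    (indepFun_dotProduct_domRestrict p fun _ : Unit => hg.orth).comp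
      (measurable_pi_apply ()) measurable_id
  have hr : Measurable fun x => g ⬝ᵥ x := by
    simp only [dotProduct]
    fun_prop
  rw [← covariance_dotProduct_coord, ← hsum]
  refine covariance_add_eq_zero_of_condIndepFun hab (measurable_pi_apply a) (measurable_pi_apply b)
    (memLp_two_coord p a) (memLp_two_coord p b) (memLp_two_dotProduct p _) hl ?_
  rw [hsum]
  exact condExp_indep_eq (m₂ := MeasurableSpace.comap Z.domRestrict inferInstance) hr.comap_le
    Z.measurable_restrict.comap_le (comap_measurable _).stronglyMeasurable hind

end Residual

section PosDef

variable {A : Matrix V V ℝ} {S : Set V}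

lemma eq_zero_of_posDef_of_forall_mulVec_eq_zero (hA : A.PosDef) {x : V → ℝ}
    (h : ∀ j ∉ S, x j = 0) (h' : ∀ j ∈ S, (A *ᵥ x) j = 0) : x = 0 := by
  by_contra hx
  refine (hA.dotProduct_mulVec_pos hx).ne' (Finset.sum_eq_zero fun j _ => ?_)
  by_cases hj : j ∈ S
  · rw [h' j hj, mul_zero]
  · simp [h j hj]

lemma IsResidual.ext (hA : A.PosDef) {a : V} {g g' : V → ℝ} (hg : IsResidual A S a g)
    (hg' : IsResidual A S a g') : g = g' := by
  classical
  rw [← sub_eq_zero]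
  refine eq_zero_of_posDef_of_forall_mulVec_eq_zero hA (S := S) (fun j hj => ?_) fun j hj => ?_
  · rw [← sub_sub_sub_cancel_right g g' (Pi.single a 1), Pi.sub_apply,
      hg.sub_single_apply_eq_zero hj, hg'.sub_single_apply_eq_zero hj, sub_zero]
  · simp [Matrix.mulVec_sub, hg.orth j hj, hg'.orth j hj]

lemma exists_isResidual (hA : A.PosDef) {a : V} (ha : a ∉ S) : ∃ g, IsResidual A S a g := by
  classical
  let T : (V → ℝ) →ₗ[ℝ] (V → ℝ) :=
    LinearMap.pi fun j => if j ∈ S then LinearMap.proj j ∘ₗ A.mulVecLin else LinearMap.proj j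
  have hT_mem {x : V → ℝ} {j : V} (hj : j ∈ S) : T x j = (A *ᵥ x) j := by simp [T, hj]
  have hT_notMem {x : V → ℝ} {j : V} (hj : j ∉ S) : T x j = x j := by simp [T, hj]
  have hinj : Function.Injective T := by
    refine (injective_iff_map_eq_zero T).2 fun x hx => ?_
    refine eq_zero_of_posDef_of_forall_mulVec_eq_zero hA (S := S) (fun j hj => ?_) fun j hj => ?_
    · rw [← hT_notMem (x := x) hj, hx, Pi.zero_apply]
    · rw [← hT_mem (x := x) hj, hx, Pi.zero_apply]
  obtain ⟨g, hg⟩ := LinearMap.injective_iff_surjective.1 hinj (Pi.single a 1)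
  refine ⟨g, ?_, fun j hj hja => ?_, fun j hj => ?_⟩
  · rw [← hT_notMem (x := g) ha, hg, Pi.single_eq_same]
  · rw [← hT_notMem (x := g) hj, hg, Pi.single_eq_of_ne hja]
  · rw [← hT_mem (x := g) hj, hg, Pi.single_eq_of_ne (ne_of_mem_of_not_mem hj ha)]

lemma IsResidual.mulVec_self_pos (hA : A.PosDef) {a : V} {g : V → ℝ} (hg : IsResidual A S a g) :
    0 < (A *ᵥ g) a := by
  have hne : g ≠ 0 := fun h => by simpa [h] using hg.self
  have hdot : g ⬝ᵥ A *ᵥ g = (A *ᵥ g) a := by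
    rw [dotProduct, Finset.sum_eq_single a, hg.self, one_mul]
    · intro j _ hj
      by_cases hS : j ∈ S
      · rw [hg.orth j hS, mul_zero]
      · rw [hg.zero j hS hj, zero_mul]
    · simp
  exact hdot ▸ hA.dotProduct_mulVec_pos hne

lemma condIndepCoords_singleton_iff {p : Measure (V → ℝ)} [IsGaussian p]
    (hp : (covMatrix p).PosDef) {i : V} {T : Set V} (hTS : T ⊆ S) (hi : i ∉ S) {g : V → ℝ}
    (hg : IsResidual (covMatrix p) S i g) :
    CondIndepCoords p {i} (S \ T) T ↔ ∀ j ∈ S \ T, g j = 0 := by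
  constructor
  · intro h j hj
    obtain ⟨g', hg'⟩ := exists_isResidual hp (mt (@hTS i) hi)
    have hg'S := hg'.mono hTS fun j hj => h.mulVec_eq_zero rfl hj hg'
    rw [hg.ext hp hg'S]
    exact hg'.zero j hj.2 (ne_of_mem_of_not_mem hj.1 hi)
  · intro h
    refine condIndepCoords_of_isResidual ?_
    rintro _ rfl
    exact ⟨g, hg.anti hTS h, fun b hb => hg.orth b hb.1⟩

end PosDef

end Gaussian

/-! ### Chain components and non-descendants -/

namespace MixedGraph

variable {V : Type*} {G : MixedGraph V}

/-- `b` is a strict descendant of `a`: some route from `a` to `b` whose edges are undirected or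
point forwards contains a directed edge. The nodes of `G.Nd {a}` are those that are not strict
descendants of `a`. -/
def StrictDesc (G : MixedGraph V) (a b : V) : Prop :=
  ∃ c d, Relation.ReflTransGen G.Step a c ∧ G.Arrow c d ∧ Relation.ReflTransGen G.Step d b

/-- `a` and `b` are joined by an undirected route, i.e. they lie in the same chain component. -/
def Linked (G : MixedGraph V) (a b : V) : Prop := Relation.ReflTransGen G.line a b

/-- The chain component of a node. -/
def comp (G : MixedGraph V) (i : V) : Set V := {j | G.Linked i j}

/-- The nodes that precede the chain component of `i`: the nodes outside this component that are
not strict descendants of `i`. -/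
def Pred (G : MixedGraph V) (i : V) : Set V := G.Nd {i} \ G.comp i

section ChainComponents

variable {i j k : V}

@[simp] lemma mem_Fa_singleton : j ∈ G.Fa {i} ↔ G.solid j i := by simp [Fa]

@[simp] lemma mem_Mo_singleton : j ∈ G.Mo {i} ↔ G.dashed j i := by simp [Mo]

@[simp] lemma mem_Pa_singleton : j ∈ G.Pa {i} ↔ G.Arrow j i := by simp [Pa, Arrow]

@[simp] lemma mem_Ne_singleton : j ∈ G.Ne {i} ↔ G.line j i := by simp [Ne]

lemma Pa_eq_Fa_union_Mo (X : Set V) : G.Pa X = G.Fa X ∪ G.Mo X := by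
  ext j
  simp only [Pa, Fa, Mo, Set.mem_ofPred_eq, Set.mem_union, and_or_left, exists_or]

lemma Linked.refl (i : V) : G.Linked i i := Relation.ReflTransGen.refl

lemma Linked.of_line (h : G.line i j) : G.Linked i j := Relation.ReflTransGen.single h

lemma Linked.symm (h : G.Linked i j) : G.Linked j i :=
  have : Std.Symm G.line := ⟨G.line_symm⟩
  Std.Symm.symm (r := Relation.ReflTransGen G.line) _ _ h

lemma Linked.trans (h : G.Linked i j) (h' : G.Linked j k) : G.Linked i k :=
  Relation.ReflTransGen.trans h h'

lemma Linked.steps (h : G.Linked i j) : Relation.ReflTransGen G.Step i j :=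
  Relation.ReflTransGen.mono (fun _ _ => Or.inr) _ _ h

lemma mem_comp_self (i : V) : i ∈ G.comp i := Linked.refl i

lemma Linked.comp_eq (h : G.Linked i j) : G.comp i = G.comp j :=
  Set.ext fun _ => ⟨h.symm.trans, h.trans⟩

lemma isConnectedSet_comp (i : V) : G.IsConnectedSet (G.comp i) :=
  fun _ ha _ hb => (Linked.symm ha).trans hb

lemma comp_mem_Cc (i : V) : G.comp i ∈ G.Cc :=
  ⟨isConnectedSet_comp i, fun _ hS hi j hj => hS i (hi (mem_comp_self i)) j hj⟩

lemma eq_comp_of_mem_Cc {K : Set V} (hK : K ∈ G.Cc) (hi : i ∈ K) : K = G.comp i :=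
  have h : K ⊆ G.comp i := hK.1 i hi
  h.antisymm (hK.2 (isConnectedSet_comp i) h)

lemma forall_mem_Cc {P : Set V → V → Prop} :
    (∀ K ∈ G.Cc, ∀ i ∈ K, P K i) ↔ ∀ i, P (G.comp i) i := by
  refine ⟨fun h i => h _ (comp_mem_Cc i) i (mem_comp_self i), fun h K hK i hi => ?_⟩
  rw [eq_comp_of_mem_Cc hK hi]
  exact h i

lemma mem_comp_sdiff_of_line (h : G.line j i) : j ∈ G.comp i \ {i} :=
  ⟨(Linked.of_line h).symm, fun hji => G.line_irrefl i (Set.mem_singleton_iff.1 hji ▸ h)⟩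

lemma IsUCG.notMem_Mo_comp (hG : G.IsUCG) (h : j ∈ G.Fa (G.comp i)) : j ∉ G.Mo (G.comp i) :=
  Set.disjoint_left.1 (hG.disjoint_Fa_Mo _ (comp_mem_Cc i)) h

end ChainComponents

section Descendants

variable {i j k l : V}

lemma StrictDesc.of_arrow (h : G.Arrow i j) : G.StrictDesc i j := ⟨i, j, .refl, h, .refl⟩

lemma StrictDesc.steps (h : G.StrictDesc i j) : Relation.ReflTransGen G.Step i j :=
  let ⟨_, _, h₁, h₂, h₃⟩ := h
  (h₁.tail (Or.inl h₂)).trans h₃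

lemma StrictDesc.trans_steps (h : G.StrictDesc i j) (h' : Relation.ReflTransGen G.Step j k) :
    G.StrictDesc i k :=
  let ⟨c, d, h₁, h₂, h₃⟩ := h
  ⟨c, d, h₁, h₂, h₃.trans h'⟩

lemma StrictDesc.steps_trans (h' : Relation.ReflTransGen G.Step i j) (h : G.StrictDesc j k) :
    G.StrictDesc i k :=
  let ⟨c, d, h₁, h₂, h₃⟩ := h
  ⟨c, d, h'.trans h₁, h₂, h₃⟩

lemma mem_Nd_singleton : j ∈ G.Nd {i} ↔ ¬ G.StrictDesc i j := by simp [Nd, StrictDesc]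

lemma Nd_comp (i : V) : G.Nd (G.comp i) = G.Nd {i} := by
  ext j
  rw [mem_Nd_singleton]
  refine not_congr ⟨?_, fun h => ⟨i, mem_comp_self i, h⟩⟩
  rintro ⟨k, hk, h⟩
  exact StrictDesc.steps_trans (Linked.steps hk) h

lemma mem_Pred : j ∈ G.Pred i ↔ ¬ G.StrictDesc i j ∧ ¬ G.Linked i j := by
  rw [Pred, Set.mem_sdiff, mem_Nd_singleton]
  rfl

lemma Linked.Pred_eq (h : G.Linked i j) : G.Pred i = G.Pred j := by
  rw [Pred, Pred, ← Nd_comp i, ← Nd_comp j, h.comp_eq]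

lemma notMem_Pred_of_linked (h : G.Linked i j) : j ∉ G.Pred i := fun hj => hj.2 h

lemma notMem_Pred_self (i : V) : i ∉ G.Pred i := notMem_Pred_of_linked (.refl i)

lemma Pred_subset_Nd_sdiff_singleton (i : V) : G.Pred i ⊆ G.Nd {i} \ {i} :=
  Set.sdiff_subset_sdiff_right (Set.singleton_subset_iff.2 (mem_comp_self i))

lemma mem_Pred_of_linked (hk : k ∈ G.Pred i) (h : G.Linked k l) : l ∈ G.Pred i := by
  obtain ⟨hik, hik'⟩ := mem_Pred.1 hk
  exact mem_Pred.2 ⟨fun h' => hik (h'.trans_steps h.symm.steps), fun h' => hik' (h'.trans h.symm)⟩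

lemma mem_Pred_of_arrow_linked (hk : k ∈ G.Pred i) (h : G.Arrow j l) (hl : G.Linked l k) :
    j ∈ G.Pred i := by
  obtain ⟨hik, -⟩ := mem_Pred.1 hk
  have hjk : G.StrictDesc j k := (StrictDesc.of_arrow h).trans_steps hl.steps
  exact mem_Pred.2 ⟨fun h' => hik (h'.trans_steps hjk.steps),
    fun h' => hik (hjk.steps_trans h'.steps)⟩

lemma adj_iff_arrow_of_mem_Pred (hj : j ∈ G.Pred i) : G.skeleton.Adj i j ↔ G.Arrow j i := by
  refine ⟨?_, fun h => Or.inr (Or.inl h)⟩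
  rintro ((h | h) | (h | h))
  · exact absurd (.of_arrow h) (mem_Pred.1 hj).1
  · exact absurd (.of_line h) hj.2
  · exact h
  · exact absurd (Linked.of_line h).symm hj.2

end Descendants

namespace IsChainGraph

variable {i j : V}

lemma not_strictDesc_self (hG : G.IsChainGraph) (i : V) : ¬ G.StrictDesc i i := by
  rintro ⟨c, d, h₁, h₂, h₃⟩
  exact hG c d h₂ (h₃.trans h₁)

lemma isStrictOrder (hG : G.IsChainGraph) : IsStrictOrder V G.StrictDesc where
  irrefl := hG.not_strictDesc_self
  trans _ _ _ h h' := h.trans_steps h'.steps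

lemma comp_subset_Nd (hG : G.IsChainGraph) (i : V) : G.comp i ⊆ G.Nd {i} :=
  fun _ hj => mem_Nd_singleton.2 fun h =>
    hG.not_strictDesc_self i (h.trans_steps (Linked.symm hj).steps)

lemma mem_Nd_sdiff_singleton (hG : G.IsChainGraph) :
    j ∈ G.Nd {i} \ {i} ↔ j ∈ G.Pred i ∨ j ∈ G.comp i \ {i} := by
  refine ⟨fun h => ?_, ?_⟩
  · by_cases hj : j ∈ G.comp i
    · exact Or.inr ⟨hj, h.2⟩
    · exact Or.inl ⟨h.1, hj⟩
  · rintro (h | h)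
    · exact Pred_subset_Nd_sdiff_singleton i h
    · exact ⟨hG.comp_subset_Nd i h.1, h.2⟩

lemma mem_Pred_or_mem_Pred (hG : G.IsChainGraph) (h : ¬ G.Linked i j) :
    j ∈ G.Pred i ∨ i ∈ G.Pred j := by
  by_contra! h'
  simp only [mem_Pred, not_and_or, not_not] at h'
  have hij := h'.1.resolve_right h
  have hji := h'.2.resolve_right fun h'' => h h''.symm
  exact hG.not_strictDesc_self i (hij.trans_steps hji.steps)

lemma Pa_comp_subset_Pred (hG : G.IsChainGraph) (i : V) : G.Pa (G.comp i) ⊆ G.Pred i := by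
  rintro j ⟨k, hk, hjk : G.Arrow j k⟩
  have hji : G.StrictDesc j i :=
    (StrictDesc.of_arrow hjk).trans_steps (Linked.symm hk).steps
  exact mem_Pred.2 ⟨fun h => hG.not_strictDesc_self i (h.trans_steps hji.steps),
    fun h => hG.not_strictDesc_self i (hji.steps_trans h.steps)⟩

lemma Fa_comp_subset_Pred (hG : G.IsChainGraph) (i : V) : G.Fa (G.comp i) ⊆ G.Pred i :=
  fun _ ⟨k, hk, h⟩ => hG.Pa_comp_subset_Pred i ⟨k, hk, Or.inl h⟩

lemma Mo_comp_subset_Pred (hG : G.IsChainGraph) (i : V) : G.Mo (G.comp i) ⊆ G.Pred i :=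
  fun _ ⟨k, hk, h⟩ => hG.Pa_comp_subset_Pred i ⟨k, hk, Or.inr h⟩

lemma mem_Pred_of_arrow (hG : G.IsChainGraph) (h : G.Arrow j i) : j ∈ G.Pred i :=
  hG.Pa_comp_subset_Pred i ⟨i, mem_comp_self i, h⟩

lemma adj_iff_line_of_linked (hG : G.IsChainGraph) (hj : G.Linked i j) :
    G.skeleton.Adj i j ↔ G.line j i := by
  refine ⟨?_, fun h => Or.inr (Or.inr h)⟩
  rintro ((h | h) | (h | h))
  · exact absurd (.of_arrow h) (mem_Nd_singleton.1 (hG.comp_subset_Nd i hj))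
  · exact G.line_symm _ _ h
  · exact absurd hj (hG.mem_Pred_of_arrow h).2
  · exact h

end IsChainGraph

end MixedGraph

/-! ### Markov properties as zeros of regression coefficients -/

namespace MixedGraph

variable {V : Type*} {G : MixedGraph V} [Fintype V]

/-- For every node `i`, the coefficient vectors `g i` and `h i` of the residuals of the regression
of `i` on the nodes preceding its chain component, and on all its other non-descendants. -/
structure IsRegression (G : MixedGraph V) (A : Matrix V V ℝ) (g h : V → V → ℝ) : Prop where
  pred : ∀ i, IsResidual A (G.Pred i) i (g i)
  full : ∀ i, IsResidual A (G.Nd {i} \ {i}) i (h i)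

/-- The zeros that a unified chain graph imposes on the coefficients of `MixedGraph.IsRegression`.
Each of the block-recursive, pairwise and local Markov properties of a Gaussian distribution is
equivalent to these. -/
structure RegressionZeros (G : MixedGraph V) (g h : V → V → ℝ) : Prop where
  pred : ∀ i, ∀ j ∈ G.Pred i, j ∉ G.Fa (G.comp i) → ¬ G.dashed j i → g i j = 0
  full : ∀ i, ∀ j ∈ G.Pred i, ¬ G.solid j i → j ∉ G.Mo (G.comp i) → h i j = 0
  line : ∀ i, ∀ j ∈ G.comp i \ {i}, ¬ G.line j i → h i j = 0

lemma exists_isRegression (G : MixedGraph V) {A : Matrix V V ℝ} (hA : A.PosDef) :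
    ∃ g h, G.IsRegression A g h := by
  choose g hg using fun i => exists_isResidual hA (notMem_Pred_self (G := G) i)
  choose h hh using fun i => exists_isResidual hA (Set.notMem_sdiff_of_mem (Set.mem_singleton i))
  exact ⟨g, h, hg, hh⟩

namespace IsRegression

variable {A : Matrix V V ℝ} {g h : V → V → ℝ}

open Classical in
lemma pred_apply_of_notMem (hr : G.IsRegression A g h) {i k j : V} (hk : G.Linked i k)
    (hj : j ∉ G.Pred i) : g k j = if j = k then 1 else 0 := by
  split_ifs with hjk
  · rw [hjk, (hr.pred k).self]
  · exact (hr.pred k).zero j (hk.Pred_eq ▸ hj) hjk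

open Classical in
lemma full_eq_sum (hr : G.IsRegression A g h) (hG : G.IsChainGraph) (hA : A.PosDef) (i : V) :
    h i = ∑ k with G.Linked i k, h i k • g k := by
  rw [← sub_eq_zero]
  refine eq_zero_of_posDef_of_forall_mulVec_eq_zero hA (S := G.Pred i) (fun l hl => ?_)
    fun l hl => ?_
  · have hsum : (∑ k with G.Linked i k, h i k • g k) l = if G.Linked i l then h i l else 0 := by
      rw [Finset.sum_apply, Finset.sum_congr rfl fun k hk => by
        rw [Pi.smul_apply, hr.pred_apply_of_notMem (Finset.mem_filter.1 hk).2 hl]]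
      simp
    rw [Pi.sub_apply, hsum]
    split_ifs with hil
    · exact sub_self _
    · have hl' : l ∉ G.Nd {i} \ {i} := fun h' =>
        (hG.mem_Nd_sdiff_singleton.1 h').elim hl fun h'' => hil h''.1
      rw [(hr.full i).zero l hl' fun hli => hil (hli ▸ .refl _), sub_zero]
  · rw [Matrix.mulVec_sub, Matrix.mulVec_sum, Pi.sub_apply,
      (hr.full i).orth l (Pred_subset_Nd_sdiff_singleton i hl), zero_sub, neg_eq_zero,
      Finset.sum_apply]
    refine Finset.sum_eq_zero fun k hk => ?_
    rw [Matrix.mulVec_smul, Pi.smul_apply,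
      (hr.pred k).orth l ((Finset.mem_filter.1 hk).2.Pred_eq ▸ hl), smul_zero]

end IsRegression

section MarkovProperties

variable {p : Measure (V → ℝ)} [IsGaussian p] {g h : V → V → ℝ} {i j : V}

lemma condIndepCoords_given_Fa_comp_iff (hG : G.IsChainGraph) (hp : (covMatrix p).PosDef)
    (hr : G.IsRegression (covMatrix p) g h) :
    CondIndepCoords p {i} ((G.Pred i \ G.Fa (G.comp i)) \ G.Mo {i}) (G.Fa (G.comp i) ∪ G.Mo {i}) ↔
      ∀ j ∈ G.Pred i, j ∉ G.Fa (G.comp i) → ¬ G.dashed j i → g i j = 0 := by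
  have hsub : G.Fa (G.comp i) ∪ G.Mo {i} ⊆ G.Pred i :=
    Set.union_subset (hG.Fa_comp_subset_Pred i) fun j hj =>
      hG.mem_Pred_of_arrow (Or.inr (mem_Mo_singleton.1 hj))
  rw [Set.sdiff_sdiff, condIndepCoords_singleton_iff hp hsub (notMem_Pred_self i) (hr.pred i)]
  simp only [Set.mem_sdiff, Set.mem_union, mem_Mo_singleton, not_or, and_imp]

lemma condIndepCoords_given_comp_iff (hG : G.IsChainGraph) (hp : (covMatrix p).PosDef)
    (hr : G.IsRegression (covMatrix p) g h) :
    CondIndepCoords p {i} ((G.Pred i \ G.Fa {i}) \ G.Mo (G.comp i))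
        (((G.comp i \ {i}) ∪ G.Fa {i}) ∪ G.Mo (G.comp i)) ↔
      ∀ j ∈ G.Pred i, ¬ G.solid j i → j ∉ G.Mo (G.comp i) → h i j = 0 := by
  have hsub : ((G.comp i \ {i}) ∪ G.Fa {i}) ∪ G.Mo (G.comp i) ⊆ G.Nd {i} \ {i} := by
    rintro j ((hj | hj) | hj) <;> rw [hG.mem_Nd_sdiff_singleton]
    · exact Or.inr hj
    · exact Or.inl (hG.mem_Pred_of_arrow (Or.inl (mem_Fa_singleton.1 hj)))
    · exact Or.inl (hG.Mo_comp_subset_Pred i hj)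
  have hsdiff : (G.Pred i \ G.Fa {i}) \ G.Mo (G.comp i) =
      (G.Nd {i} \ {i}) \ (((G.comp i \ {i}) ∪ G.Fa {i}) ∪ G.Mo (G.comp i)) := by
    ext j
    have := fun hj : j ∈ G.Pred i => hj.2
    simp only [Set.mem_sdiff (s := G.Nd {i} \ {i}), hG.mem_Nd_sdiff_singleton]
    simp only [Set.mem_sdiff, Set.mem_union]
    tauto
  rw [hsdiff, condIndepCoords_singleton_iff hp hsub (Set.notMem_sdiff_of_mem rfl) (hr.full i),
    ← hsdiff]
  simp only [Set.mem_sdiff, mem_Fa_singleton, and_imp]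

lemma condIndepCoords_within_comp_iff (hG : G.IsChainGraph) (hp : (covMatrix p).PosDef)
    (hr : G.IsRegression (covMatrix p) g h)
    (hfull : ∀ j ∈ G.Pred i, ¬ G.solid j i → j ∉ G.Mo (G.comp i) → h i j = 0)
    (hj : j ∈ G.comp i \ {i}) :
    CondIndepCoords p {i} {j} ((G.comp i \ {i, j}) ∪ G.Pa (G.comp i)) ↔ h i j = 0 := by
  have hPa := hG.Pa_comp_subset_Pred i
  have hres : IsResidual (covMatrix p) ((G.comp i \ {i}) ∪ G.Pa (G.comp i)) i (h i) := by
    refine (hr.full i).anti (fun l hl => hG.mem_Nd_sdiff_singleton.2 ?_) fun l hl => ?_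
    · exact hl.symm.imp_left (@hPa l)
    · rw [Set.mem_sdiff, hG.mem_Nd_sdiff_singleton, Pa_eq_Fa_union_Mo] at hl
      exact hfull l (hl.1.resolve_right fun h' => hl.2 (Or.inl h'))
        (fun h' => hl.2 (Or.inr (Or.inl ⟨i, mem_comp_self i, h'⟩)))
        fun h' => hl.2 (Or.inr (Or.inr h'))
  have hi : i ∉ (G.comp i \ {i}) ∪ G.Pa (G.comp i) := fun hi =>
    hi.elim (fun h' => h'.2 rfl) fun h' => notMem_Pred_self i (hPa h')
  have hsdiff : ((G.comp i \ {i}) ∪ G.Pa (G.comp i)) \ ((G.comp i \ {i, j}) ∪ G.Pa (G.comp i)) =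
      {j} := by
    ext l
    have hjPa : j ∉ G.Pa (G.comp i) := fun h' => (hPa h').2 hj.1
    obtain ⟨hj, hji⟩ := hj
    by_cases hlj : l = j
    · subst hlj
      simp_all
    · simp [hlj]
      tauto
  have hsub : (G.comp i \ {i, j}) ∪ G.Pa (G.comp i) ⊆ (G.comp i \ {i}) ∪ G.Pa (G.comp i) :=
    Set.union_subset_union_left _ (Set.sdiff_subset_sdiff_right (by simp))
  simpa only [hsdiff, Set.mem_singleton_iff, forall_eq] using
    condIndepCoords_singleton_iff hp hsub hi hres

lemma condIndepCoords_sdiff_singleton_iff {S : Set V} (hp : (covMatrix p).PosDef) (hi : i ∉ S)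
    {g : V → ℝ} (hg : IsResidual (covMatrix p) S i g) (hj : j ∈ S) :
    CondIndepCoords p {i} {j} (S \ {j}) ↔ g j = 0 := by
  simpa only [Set.sdiff_sdiff_cancel_left (Set.singleton_subset_iff.2 hj), Set.mem_singleton_iff,
    forall_eq] using condIndepCoords_singleton_iff hp Set.sdiff_subset hi hg (T := S \ {j})

lemma condIndepCoords_given_boundary_iff (hG : G.IsChainGraph) (hp : (covMatrix p).PosDef)
    (hr : G.IsRegression (covMatrix p) g h) :
    CondIndepCoords p {i} ((((G.Nd {i} \ {i}) \ G.Pa {i}) \ G.Ne {i}) \ G.Mo (G.Ne {i}))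
        ((G.Pa {i} ∪ G.Ne {i}) ∪ G.Mo (G.Ne {i})) ↔
      ∀ j ∈ G.Nd {i} \ {i}, ¬ G.Arrow j i → ¬ G.line j i → j ∉ G.Mo (G.Ne {i}) → h i j = 0 := by
  have hsub : (G.Pa {i} ∪ G.Ne {i}) ∪ G.Mo (G.Ne {i}) ⊆ G.Nd {i} \ {i} := by
    rintro j ((hj | hj) | ⟨k, hk, hj⟩) <;> rw [hG.mem_Nd_sdiff_singleton]
    · exact Or.inl (hG.mem_Pred_of_arrow (mem_Pa_singleton.1 hj))
    · exact Or.inr (mem_comp_sdiff_of_line (mem_Ne_singleton.1 hj))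
    · exact Or.inl (hG.Mo_comp_subset_Pred i
        ⟨k, (Linked.of_line (mem_Ne_singleton.1 hk)).symm, hj⟩)
  rw [Set.sdiff_sdiff, Set.sdiff_sdiff, ← Set.union_assoc,
    condIndepCoords_singleton_iff hp hsub (Set.notMem_sdiff_of_mem rfl) (hr.full i)]
  simp only [Set.mem_sdiff (s := _ \ _), Set.mem_union, mem_Pa_singleton, mem_Ne_singleton, not_or,
    and_imp]

lemma blockRecursiveMarkov_iff (hG : G.IsChainGraph) (hp : (covMatrix p).PosDef)
    (hr : G.IsRegression (covMatrix p) g h) :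
    G.BlockRecursiveMarkov p ↔ G.RegressionZeros g h := by
  rw [BlockRecursiveMarkov, forall_mem_Cc]
  simp only [Nd_comp]
  constructor
  · intro H
    have hfull i := (condIndepCoords_given_comp_iff hG hp hr).1 (H i).2.1
    exact {
      pred i := (condIndepCoords_given_Fa_comp_iff hG hp hr).1 (H i).1
      full := hfull
      line i j hj hji := (condIndepCoords_within_comp_iff hG hp hr (hfull i) hj).1
        ((H i).2.2 j ⟨hj, mt mem_Ne_singleton.1 hji⟩) }
  · intro H i
    exact ⟨(condIndepCoords_given_Fa_comp_iff hG hp hr).2 (H.pred i),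
      (condIndepCoords_given_comp_iff hG hp hr).2 (H.full i), fun j hj =>
        (condIndepCoords_within_comp_iff hG hp hr (H.full i) hj.1).2
          (H.line i j hj.1 (mt mem_Ne_singleton.2 hj.2))⟩

lemma pairwiseMarkov_iff (hG : G.IsChainGraph) (hp : (covMatrix p).PosDef)
    (hr : G.IsRegression (covMatrix p) g h) :
    G.PairwiseMarkov p ↔ G.RegressionZeros g h := by
  have hpred {i j : V} (hj : j ∈ G.Pred i) :=
    condIndepCoords_sdiff_singleton_iff hp (notMem_Pred_self i) (hr.pred i) hj
  have hfull {i j : V} (hj : j ∈ G.Nd {i} \ {i}) :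
      CondIndepCoords p {i} {j} (G.Nd {i} \ {i, j}) ↔ h i j = 0 := by
    rw [Set.insert_eq, ← Set.sdiff_sdiff]
    exact condIndepCoords_sdiff_singleton_iff hp (fun hi => hi.2 rfl) (hr.full i) hj
  rw [PairwiseMarkov, forall_mem_Cc]
  constructor
  · intro H
    refine ⟨fun i j hj hFa hMo => ?_, fun i j hj hFa hMo => ?_, fun i j hj hji => ?_⟩
    · have hadj : ¬ G.skeleton.Adj i j := fun hadj =>
        ((adj_iff_arrow_of_mem_Pred hj).1 hadj).elim (fun h' => hFa ⟨i, mem_comp_self i, h'⟩) hMo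
      exact (hpred hj).1 ((H i j hadj).1 ⟨⟨hj, hFa⟩, mt mem_Mo_singleton.1 hMo⟩)
    · have hadj : ¬ G.skeleton.Adj i j := fun hadj =>
        ((adj_iff_arrow_of_mem_Pred hj).1 hadj).elim hFa fun h' => hMo ⟨i, mem_comp_self i, h'⟩
      have hj' := Pred_subset_Nd_sdiff_singleton i hj
      exact (hfull hj').1 ((H i j hadj).2 ⟨⟨hj', mt mem_Fa_singleton.1 hFa⟩, hMo⟩)
    · have hadj : ¬ G.skeleton.Adj i j := mt (hG.adj_iff_line_of_linked hj.1).1 hji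
      have hj' := hG.mem_Nd_sdiff_singleton.2 (Or.inr hj)
      have hFa : j ∉ G.Fa {i} := fun h' =>
        (hG.mem_Pred_of_arrow (Or.inl (mem_Fa_singleton.1 h'))).2 hj.1
      exact (hfull hj').1 ((H i j hadj).2
        ⟨⟨hj', hFa⟩, fun h' => (hG.Mo_comp_subset_Pred i h').2 hj.1⟩)
  · intro H i j hadj
    refine ⟨fun hj => (hpred hj.1.1).2 ?_, fun hj => (hfull hj.1.1).2 ?_⟩
    · exact H.pred i j hj.1.1 hj.1.2 (mt mem_Mo_singleton.2 hj.2)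
    · rcases hG.mem_Nd_sdiff_singleton.1 hj.1.1 with hj' | hj'
      · exact H.full i j hj' (mt mem_Fa_singleton.2 hj.1.2) hj.2
      · exact H.line i j hj' (mt (hG.adj_iff_line_of_linked hj'.1).2 hadj)

lemma RegressionZeros.full_eq_zero_of_notMem_boundary (H : G.RegressionZeros g h) (hG : G.IsUCG)
    {A : Matrix V V ℝ} (hA : A.PosDef) (hr : G.IsRegression A g h) (hj : j ∈ G.Nd {i} \ {i})
    (hPa : ¬ G.Arrow j i) (hNe : ¬ G.line j i) (hMo : j ∉ G.Mo (G.Ne {i})) : h i j = 0 := by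
  classical
  have hc := hG.isChainGraph
  rcases hc.mem_Nd_sdiff_singleton.1 hj with hj' | hj'
  swap
  · exact H.line i j hj' hNe
  by_cases hjMo : j ∈ G.Mo (G.comp i)
  swap
  · exact H.full i j hj' (fun h' => hPa (Or.inl h')) hjMo
  rw [hr.full_eq_sum hc hA i, Finset.sum_apply]
  refine Finset.sum_eq_zero fun k hk => ?_
  have hk : G.Linked i k := (Finset.mem_filter.1 hk).2
  rw [Pi.smul_apply, smul_eq_mul, mul_eq_zero, or_iff_not_imp_left]
  intro hik
  refine H.pred k j (hk.Pred_eq ▸ hj') (fun h' => hG.notMem_Mo_comp (hk.comp_eq ▸ h') hjMo) ?_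
  by_cases hki : k = i
  · exact hki ▸ fun h' => hPa (Or.inr h')
  · have hline : G.line k i := not_imp_comm.1 (H.line i k ⟨hk, hki⟩) hik
    exact fun h' => hMo ⟨k, mem_Ne_singleton.2 hline, h'⟩

lemma localMarkov_iff (hG : G.IsUCG) (hp : (covMatrix p).PosDef)
    (hr : G.IsRegression (covMatrix p) g h) :
    G.LocalMarkov p ↔ G.RegressionZeros g h := by
  have hc := hG.isChainGraph
  rw [LocalMarkov, forall_mem_Cc]
  constructor
  · intro H
    have hMo {i j : V} (h' : j ∈ G.Mo (G.Ne {i})) : j ∈ G.Mo (G.comp i) :=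
      let ⟨k, hk, hjk⟩ := h'
      ⟨k, (Linked.of_line (mem_Ne_singleton.1 hk)).symm, hjk⟩
    have hboundary i := (condIndepCoords_given_boundary_iff hc hp hr).1 (H i).2
    refine ⟨fun i => (condIndepCoords_given_Fa_comp_iff hc hp hr).1 (H i).1,
      fun i j hj hFa hjMo =>
        hboundary i j (Pred_subset_Nd_sdiff_singleton i hj) ?_ ?_ (mt hMo hjMo),
      fun i j hj hji => hboundary i j (hc.mem_Nd_sdiff_singleton.2 (Or.inr hj)) ?_ hji ?_⟩
    · exact not_or.2 ⟨hFa, fun h' => hjMo ⟨i, mem_comp_self i, h'⟩⟩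
    · exact fun h' => hj.2 (mem_comp_sdiff_of_line h').1
    · exact fun h' => (hc.mem_Pred_of_arrow h').2 hj.1
    · exact fun h' => (hc.Mo_comp_subset_Pred i (hMo h')).2 hj.1
  · intro H i
    exact ⟨(condIndepCoords_given_Fa_comp_iff hc hp hr).2 (H.pred i),
      (condIndepCoords_given_boundary_iff hc hp hr).2 fun j hj =>
        H.full_eq_zero_of_notMem_boundary hG hp hr hj⟩

end MarkovProperties

end MixedGraph

/-! ### Factorization of the precision matrix -/

lemma dotProduct_mulVec_comm_of_isSymm {V α : Type*} [Fintype V] [NonUnitalCommSemiring α]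
    {A : Matrix V V α} (hA : A.IsSymm) (x y : V → α) : x ⬝ᵥ A *ᵥ y = y ⬝ᵥ A *ᵥ x := by
  rw [← Matrix.dotProduct_transpose_mulVec, hA.eq]

lemma mulVec_indicator_apply {m n α : Type*} [Fintype n] [NonUnitalNonAssocSemiring α]
    (M : Matrix m n α) (x : n → α) {S : Set n} {S' : Set m} {i : m}
    (h : ∀ j, M i j ≠ 0 → x j ≠ 0 → (j ∈ S ↔ i ∈ S')) :
    (M *ᵥ S.indicator x) i = S'.indicator (M *ᵥ x) i := by
  by_cases hi : i ∈ S'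
  · rw [Set.indicator_of_mem hi]
    refine Finset.sum_congr rfl fun j _ => ?_
    by_cases hx : M i j = 0 ∨ x j = 0
    · rcases hx with hx | hx <;> simp [hx, Set.indicator]
    · rw [not_or] at hx
      rw [Set.indicator_of_mem ((h j hx.1 hx.2).2 hi)]
  · rw [Set.indicator_of_notMem hi]
    refine Finset.sum_eq_zero fun j _ => ?_
    by_cases hx : M i j = 0 ∨ x j = 0
    · rcases hx with hx | hx <;> simp [hx, Set.indicator]
    · rw [not_or] at hx
      rw [Set.indicator_of_notMem (mt (h j hx.1 hx.2).1 hi), mul_zero]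

lemma posDef_of_transpose_mul_mul_mul_eq_one {n : Type*} [Fintype n] [DecidableEq n]
    {A U W : Matrix n n ℝ} (hA : A.PosDef) (h : Uᵀ * (W * U * A) = 1) : W.PosDef := by
  have hinv : A⁻¹ = Uᵀ * W * U :=
    Matrix.inv_eq_left_inv (by rw [← h]; simp only [Matrix.mul_assoc])
  have hU : IsUnit U := by
    rw [← Matrix.isUnit_transpose]
    exact IsUnit.of_mul_eq_one _ h
  refine (Matrix.IsUnit.posDef_star_left_conjugate_iff hU).1 ?_
  rw [Matrix.star_eq_conjTranspose, Matrix.conjTranspose_eq_transpose_of_trivial, ← hinv]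
  exact hA.inv

namespace MixedGraph

variable {V : Type*} {G : MixedGraph V} [Fintype V]

open Classical in
/-- A factorization `A⁻¹ = (1 - B - F)ᵀ W (1 - B - F)` into matrices whose supports are given by the
undirected, dashed and solid edges of `G`. It is `W * F`, not `F`, that is supported on the solid
edges: they carry partial regression coefficients given the rest of the chain component. -/
structure Factorization (G : MixedGraph V) (A W B F : Matrix V V ℝ) : Prop where
  posDef : W.PosDef
  line : ∀ i j, W i j ≠ 0 → i = j ∨ G.line i j
  dashed : ∀ i j, B i j ≠ 0 → G.dashed j i
  father : ∀ i j, F i j ≠ 0 → j ∈ G.Fa (G.comp i)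
  solid : ∀ i j, (W * F) i j ≠ 0 → G.solid j i
  factor : (1 - B - F)ᵀ * (W * (1 - B - F) * A) = 1

section Existence

variable {A : Matrix V V ℝ} {g h : V → V → ℝ}

open Classical in
/-- The matrix `W` of `MixedGraph.Factorization`: the block of the chain component of `i` is the
inverse covariance matrix of the residuals with coefficient vectors `g k`, expressed through the
coefficients of the full regressions. -/
noncomputable def concentration (G : MixedGraph V) (A : Matrix V V ℝ) (h : V → V → ℝ) :
    Matrix V V ℝ :=
  Matrix.of fun i k => if G.Linked i k then h i k / (A *ᵥ h i) i else 0

open Classical in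
/-- The matrix `B` of `MixedGraph.Factorization`: the regression coefficients of the mothers. -/
noncomputable def dashedCoeff (G : MixedGraph V) (g : V → V → ℝ) : Matrix V V ℝ :=
  Matrix.of fun i j => if G.dashed j i then -g i j else 0

open Classical in
/-- The matrix `F` of `MixedGraph.Factorization`: the regression coefficients of the fathers of the
chain component. -/
noncomputable def fatherCoeff (G : MixedGraph V) (g : V → V → ℝ) : Matrix V V ℝ :=
  Matrix.of fun i j => if j ∈ G.Fa (G.comp i) then -g i j else 0

open Classical in
lemma one_sub_dashedCoeff_sub_fatherCoeff (hG : G.IsUCG) (hr : G.IsRegression A g h)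
    (H : G.RegressionZeros g h) : 1 - G.dashedCoeff g - G.fatherCoeff g = Matrix.of g := by
  ext i j
  simp only [Matrix.sub_apply, Matrix.one_apply, dashedCoeff, fatherCoeff, Matrix.of_apply]
  by_cases hj : j ∈ G.Pred i
  · rw [if_neg fun hij : i = j => notMem_Pred_self j (hij ▸ hj)]
    by_cases hd : G.dashed j i
    · have hF : j ∉ G.Fa (G.comp i) := fun h => hG.notMem_Mo_comp h ⟨i, mem_comp_self i, hd⟩
      simp [hd, hF]
    · by_cases hF : j ∈ G.Fa (G.comp i)
      · simp [hd, hF]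
      · simp [hd, hF, H.pred i j hj hF hd]
  · have hd : ¬ G.dashed j i := fun h => hj (hG.isChainGraph.mem_Pred_of_arrow (Or.inr h))
    have hF : j ∉ G.Fa (G.comp i) := fun h => hj (hG.isChainGraph.Fa_comp_subset_Pred i h)
    simp [hd, hF, hr.pred_apply_of_notMem (.refl i) hj, eq_comm]

lemma concentration_mul_pred_apply (hG : G.IsChainGraph) (hA : A.PosDef)
    (hr : G.IsRegression A g h) (i j : V) :
    (G.concentration A h * Matrix.of g) i j = h i j / (A *ᵥ h i) i := by
  classical
  have hsum : h i j = ∑ k with G.Linked i k, h i k * g k j := by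
    simpa only [Finset.sum_apply, Pi.smul_apply, smul_eq_mul] using
      congrFun (hr.full_eq_sum hG hA i) j
  rw [hsum, Finset.sum_filter, Finset.sum_div, Matrix.mul_apply]
  refine Finset.sum_congr rfl fun k _ => ?_
  by_cases hk : G.Linked i k
  · simp only [concentration, Matrix.of_apply, hk, if_true]
    ring
  · simp [concentration, hk]

lemma full_dotProduct_mulVec_pred_of_linked (hG : G.IsChainGraph) (hA : A.PosDef)
    (hr : G.IsRegression A g h) {i k : V} (hik : G.Linked i k) :
    h i ⬝ᵥ A *ᵥ g k = (A *ᵥ h i) i * g k i := by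
  rw [dotProduct_mulVec_comm_of_isSymm (Matrix.isHermitian_iff_isSymm.1 hA.isHermitian), dotProduct,
    Finset.sum_eq_single i, mul_comm]
  · intro j _ hj
    by_cases hN : j ∈ G.Nd {i} \ {i}
    · rw [(hr.full i).orth j hN, mul_zero]
    · have hjk : ¬ (j ∈ G.Pred i ∨ j ∈ G.comp i \ {i}) := mt hG.mem_Nd_sdiff_singleton.2 hN
      rw [hr.pred_apply_of_notMem hik fun h => hjk (Or.inl h),
        if_neg fun h : j = k => hjk (Or.inr ⟨h ▸ hik, hj⟩), zero_mul]
  · simp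

lemma full_dotProduct_mulVec_pred_of_right_mem_Pred (hA : A.PosDef) (hr : G.IsRegression A g h)
    (H : G.RegressionZeros g h) {i k : V} (hk : k ∈ G.Pred i) : h i ⬝ᵥ A *ᵥ g k = 0 := by
  rw [dotProduct_mulVec_comm_of_isSymm (Matrix.isHermitian_iff_isSymm.1 hA.isHermitian)]
  refine Finset.sum_eq_zero fun j _ => ?_
  by_cases hj : j ∈ G.Pred i
  · rw [(hr.full i).orth j (Pred_subset_Nd_sdiff_singleton i hj), mul_zero]
  suffices g k j = 0 by rw [this, zero_mul]
  by_cases hjk : j ∈ G.Pred k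
  · refine H.pred k j hjk ?_ fun h => hj (mem_Pred_of_arrow_linked hk (Or.inr h) (.refl k))
    rintro ⟨l, hl, h⟩
    exact hj (mem_Pred_of_arrow_linked hk (Or.inl h) (Linked.symm hl))
  · exact (hr.pred k).zero j hjk fun h => hj (h ▸ hk)

lemma full_dotProduct_mulVec_pred_of_left_mem_Pred (hG : G.IsChainGraph) (hr : G.IsRegression A g h)
    (H : G.RegressionZeros g h) {i k : V} (hi : i ∈ G.Pred k) : h i ⬝ᵥ A *ᵥ g k = 0 := by
  refine Finset.sum_eq_zero fun j _ => ?_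
  by_cases hj : j ∈ G.Pred k
  · rw [(hr.pred k).orth j hj, mul_zero]
  suffices h i j = 0 by rw [this, zero_mul]
  by_cases hN : j ∈ G.Nd {i} \ {i}
  · rcases hG.mem_Nd_sdiff_singleton.1 hN with hji | hji
    · refine H.full i j hji (fun h => hj (mem_Pred_of_arrow_linked hi (Or.inl h) (.refl i))) ?_
      rintro ⟨l, hl, h⟩
      exact hj (mem_Pred_of_arrow_linked hi (Or.inr h) (Linked.symm hl))
    · exact absurd (mem_Pred_of_linked hi hji.1) hj
  · exact (hr.full i).zero j hN fun h => hj (h ▸ hi)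

open Classical in
lemma concentration_mul_pred_mul_mul_transpose (hG : G.IsChainGraph) (hA : A.PosDef)
    (hr : G.IsRegression A g h) (H : G.RegressionZeros g h) :
    G.concentration A h * Matrix.of g * A * (Matrix.of g)ᵀ = 1 := by
  ext i k
  have hdot : (G.concentration A h * Matrix.of g * A * (Matrix.of g)ᵀ) i k =
      (h i ⬝ᵥ A *ᵥ g k) / (A *ᵥ h i) i := by
    rw [Matrix.mul_assoc, Matrix.mul_apply, dotProduct, Finset.sum_div]
    refine Finset.sum_congr rfl fun j _ => ?_
    rw [concentration_mul_pred_apply hG hA hr, div_mul_eq_mul_div]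
    rfl
  rw [hdot, Matrix.one_apply]
  by_cases hik : G.Linked i k
  · rw [full_dotProduct_mulVec_pred_of_linked hG hA hr hik,
      mul_div_cancel_left₀ _ ((hr.full i).mulVec_self_pos hA).ne',
      hr.pred_apply_of_notMem hik (notMem_Pred_self i)]
  · rw [if_neg fun h : i = k => hik (h ▸ .refl i), div_eq_zero_iff]
    exact Or.inl ((hG.mem_Pred_or_mem_Pred hik).elim
      (full_dotProduct_mulVec_pred_of_right_mem_Pred hA hr H)
      (full_dotProduct_mulVec_pred_of_left_mem_Pred hG hr H))

lemma concentration_apply_eq_zero (H : G.RegressionZeros g h) {i j : V} (hij : i ≠ j)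
    (hline : ¬ G.line i j) : G.concentration A h i j = 0 := by
  simp only [concentration, Matrix.of_apply]
  split_ifs with hl
  · rw [H.line i j ⟨hl, hij.symm⟩ fun h' => hline (G.line_symm _ _ h'), zero_div]
  · rfl

lemma concentration_mul_fatherCoeff_apply_eq_zero (hG : G.IsUCG) (hA : A.PosDef)
    (hr : G.IsRegression A g h) (H : G.RegressionZeros g h) {i j : V} (hsolid : ¬ G.solid j i) :
    (G.concentration A h * G.fatherCoeff g) i j = 0 := by
  have hterm (k : V) : G.concentration A h i k * G.fatherCoeff g k j =
      G.concentration A h i k * G.fatherCoeff (fun _ => g k) i j := by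
    by_cases hk : G.Linked i k
    · simp only [fatherCoeff, Matrix.of_apply]
      rw [hk.comp_eq]
    · simp [concentration, hk]
  rw [Matrix.mul_apply, Finset.sum_congr rfl fun k _ => hterm k]
  by_cases hj : j ∈ G.Fa (G.comp i)
  · have hfull : h i j = 0 :=
      H.full i j (hG.isChainGraph.Fa_comp_subset_Pred i hj) hsolid (hG.notMem_Mo_comp hj)
    have hmul := concentration_mul_pred_apply hG.isChainGraph hA hr i j
    rw [hfull, zero_div, Matrix.mul_apply] at hmul
    simpa [fatherCoeff, hj] using hmul
  · simp [fatherCoeff, hj]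

lemma exists_factorization (hG : G.IsUCG) (hA : A.PosDef) (hr : G.IsRegression A g h)
    (H : G.RegressionZeros g h) : ∃ W B F : Matrix V V ℝ, G.Factorization A W B F := by
  classical
  have hfactor : (1 - G.dashedCoeff g - G.fatherCoeff g)ᵀ *
      (G.concentration A h * (1 - G.dashedCoeff g - G.fatherCoeff g) * A) = 1 := by
    rw [one_sub_dashedCoeff_sub_fatherCoeff hG hr H, mul_eq_one_comm]
    exact concentration_mul_pred_mul_mul_transpose hG.isChainGraph hA hr H
  refine ⟨G.concentration A h, G.dashedCoeff g, G.fatherCoeff g,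
    posDef_of_transpose_mul_mul_mul_eq_one hA hfactor, fun i j hij => ?_, fun i j => ?_,
    fun i j => ?_, fun i j => ?_, by convert hfactor⟩
  · by_contra! h'
    exact hij (concentration_apply_eq_zero H h'.1 h'.2)
  · exact fun hij => of_not_not fun h' => hij (if_neg h')
  · exact fun hij => of_not_not fun h' => hij (if_neg h')
  · exact not_imp_comm.1 (concentration_mul_fatherCoeff_apply_eq_zero hG hA hr H)

end Existence

end MixedGraph

/-! ### Separations force zero partial regression coefficients -/

namespace MixedGraph

variable {V : Type*} {G : MixedGraph V}

/-- The union of the chain components that meet `R`. -/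
def compClosure (G : MixedGraph V) (R : Set V) : Set V := {i | ∃ k ∈ R, G.Linked i k}

/-- The nodes at which no `Z`-open route can arrive along an undirected edge and continue: they are
in `Z`, so that the route would have to leave them towards a mother, and all their mothers are
in `Z`. -/
def barrier (G : MixedGraph V) (Z : Set V) : Set V := {i | i ∈ Z ∧ ∀ m, G.dashed m i → m ∈ Z}

/-- A separation of `a` from `b` given `Z` that is compatible with the edges of `G`: `R` consists of
the nodes that are relevant, `P` of the nodes on the side of `a`, and `T` marks the chain components
on the side of `a`. Outside `Z` and the barrier, the edges between relevant nodes do not change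
sides. -/
structure IsSeparation (G : MixedGraph V) (Z : Set V) (a b : V) (R P T : Set V) : Prop where
  left_mem : a ∈ R ∩ P
  right_mem : b ∈ R \ P
  subset : Z ⊆ R
  mem_of_dashed : ∀ i j, G.dashed i j → j ∈ R → i ∈ R
  mem_of_solid : ∀ i j, G.solid i j → j ∈ G.compClosure R → i ∈ R
  iff_of_dashed : ∀ m i, G.dashed m i → m ∉ Z → i ∈ R → (m ∈ P ↔ i ∈ P)
  iff_of_line : ∀ i j, G.line i j → i ∉ G.barrier Z → j ∉ G.barrier Z → (i ∈ P ↔ j ∈ P)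
  iff_of_solid : ∀ f i, G.solid f i → f ∉ Z → i ∈ G.compClosure R → i ∉ G.barrier Z →
    (f ∈ P ↔ i ∈ P)
  comp_iff_of_line : ∀ i j, G.line i j → (i ∈ T ↔ j ∈ T)
  comp_iff_of_solid : ∀ f i, G.solid f i → f ∉ Z → i ∈ G.compClosure R → (f ∈ P ↔ i ∈ T)

lemma subset_compClosure (R : Set V) : R ⊆ G.compClosure R := fun i hi => ⟨i, hi, .refl i⟩

lemma Linked.mem_compClosure_iff {R : Set V} {i j : V} (h : G.Linked i j) :
    i ∈ G.compClosure R ↔ j ∈ G.compClosure R :=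
  ⟨fun ⟨k, hk, hik⟩ => ⟨k, hk, h.symm.trans hik⟩, fun ⟨k, hk, hjk⟩ => ⟨k, hk, h.trans hjk⟩⟩

variable [Fintype V]

/-- The vector `(1 - B - F) *ᵥ c`. -/
def innovation (B F : Matrix V V ℝ) (c : V → ℝ) : V → ℝ := c - B *ᵥ c - F *ᵥ c

/-- The part of `innovation B F c` that lies on the side of `b` in a separation of `a` from `b`. The
contribution of the fathers is cut along chain components, the rest along nodes. -/
noncomputable def cutInnovation (G : MixedGraph V) (R P T : Set V) (B F : Matrix V V ℝ)
    (c : V → ℝ) : V → ℝ :=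
  (G.compClosure R \ P).indicator (c - B *ᵥ c) - (G.compClosure R \ T).indicator (F *ᵥ c)

variable {A W B F : Matrix V V ℝ} {Z R P T : Set V} {a b i j : V} {γ c : V → ℝ}

namespace Factorization

lemma linked (hf : G.Factorization A W B F) (hW : W i j ≠ 0) : G.Linked i j := by
  rcases hf.line i j hW with rfl | h
  · exact .refl _
  · exact .of_line h

lemma isSymm (hf : G.Factorization A W B F) : W.IsSymm :=
  Matrix.isHermitian_iff_isSymm.1 hf.posDef.isHermitian

lemma transpose_mul_mulVec (hf : G.Factorization A W B F) (y : V → ℝ) :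
    (W * F)ᵀ *ᵥ y = Fᵀ *ᵥ (W *ᵥ y) := by
  rw [Matrix.transpose_mul, hf.isSymm.eq, Matrix.mulVec_mulVec]

lemma sub_transpose_mulVec_eq (hf : G.Factorization A W B F) (γ : V → ℝ) :
    W *ᵥ innovation B F (A *ᵥ γ) - Bᵀ *ᵥ (W *ᵥ innovation B F (A *ᵥ γ)) -
      Fᵀ *ᵥ (W *ᵥ innovation B F (A *ᵥ γ)) = γ := by
  classical
  have h : ((1 - B - F)ᵀ * (W * (1 - B - F) * A)) *ᵥ γ = γ := by
    rw [show (1 - B - F)ᵀ * (W * (1 - B - F) * A) = 1 by convert hf.factor, Matrix.one_mulVec]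
  simpa only [innovation, ← Matrix.mulVec_mulVec, Matrix.transpose_sub, Matrix.transpose_one,
    Matrix.sub_mulVec, Matrix.one_mulVec] using h

lemma mulVec_innovation_apply_eq (hf : G.Factorization A W B F) (hγ : IsResidual A Z a γ)
    (hj : j ∉ Z) (hja : j ≠ a) :
    (W *ᵥ innovation B F (A *ᵥ γ)) j =
      (Bᵀ *ᵥ (W *ᵥ innovation B F (A *ᵥ γ))) j + (Fᵀ *ᵥ (W *ᵥ innovation B F (A *ᵥ γ))) j := by
  have h := congrFun (hf.sub_transpose_mulVec_eq γ) j
  rw [hγ.zero j hj hja, Pi.sub_apply, Pi.sub_apply] at h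
  linarith

lemma mulVec_innovation_eq_zero_of_notMem (hG : G.IsChainGraph) (hf : G.Factorization A W B F)
    (hs : G.IsSeparation Z a b R P T) (hγ : IsResidual A Z a γ) (hj : j ∉ R) :
    (W *ᵥ innovation B F (A *ᵥ γ)) j = 0 := by
  have := hG.isStrictOrder
  induction j using (Finite.wellFounded_of_trans_of_irrefl
    (Function.swap G.StrictDesc)).induction with
  | _ j ih =>
    have hB : (Bᵀ *ᵥ (W *ᵥ innovation B F (A *ᵥ γ))) j = 0 := Finset.sum_eq_zero fun i _ => by
      by_cases hij : B i j = 0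
      · simp [hij]
      · have hd := hf.dashed i j hij
        rw [ih i (.of_arrow (Or.inr hd)) fun h => hj (hs.mem_of_dashed j i hd h), mul_zero]
    have hF : (Fᵀ *ᵥ (W *ᵥ innovation B F (A *ᵥ γ))) j = 0 := Finset.sum_eq_zero fun i _ => by
      by_cases hij : F i j = 0
      · simp [hij]
      · obtain ⟨k, hk, hjk⟩ := hf.father i j hij
        have hki : G.Linked k i := Linked.symm hk
        rw [ih i ((StrictDesc.of_arrow (Or.inl hjk)).trans_steps hki.steps)
          fun h => hj (hs.mem_of_solid j k hjk ⟨i, h, hki⟩), mul_zero]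
    rw [hf.mulVec_innovation_apply_eq hγ (mt (@hs.subset j) hj) fun h => hj (h ▸ hs.left_mem.1),
      hB, hF, add_zero]

lemma innovation_eq_zero_of_notMem (hG : G.IsChainGraph) (hf : G.Factorization A W B F)
    (hs : G.IsSeparation Z a b R P T) (hγ : IsResidual A Z a γ) (hi : i ∉ G.compClosure R) :
    innovation B F (A *ᵥ γ) i = 0 := by
  have hzero : (G.compClosure R)ᶜ.indicator (innovation B F (A *ᵥ γ)) = 0 := by
    refine eq_zero_of_posDef_of_forall_mulVec_eq_zero hf.posDef (S := (G.compClosure R)ᶜ)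
      (fun j hj => Set.indicator_of_notMem hj _) fun j hj => ?_
    rw [mulVec_indicator_apply (S := (G.compClosure R)ᶜ) (S' := (G.compClosure R)ᶜ) W _
      fun k hk _ => not_congr (hf.linked hk).mem_compClosure_iff.symm, Set.indicator_of_mem hj]
    exact hf.mulVec_innovation_eq_zero_of_notMem hG hs hγ fun h => hj (subset_compClosure R h)
  rw [← Set.indicator_of_mem (s := (G.compClosure R)ᶜ) hi (innovation B F (A *ᵥ γ)), hzero,
    Pi.zero_apply]

lemma sub_mulVec_eq_zero_of_mem_barrier (hf : G.Factorization A W B F) (hc : ∀ z ∈ Z, c z = 0)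
    (hi : i ∈ G.barrier Z) : (c - B *ᵥ c) i = 0 := by
  have hB : (B *ᵥ c) i = 0 := Finset.sum_eq_zero fun m _ => by
    by_cases hm : B i m = 0
    · simp [hm]
    · rw [hc m (hi.2 m (hf.dashed i m hm)), mul_zero]
  rw [Pi.sub_apply, hB, hc i hi.1, sub_zero]

lemma mulVec_indicator_mulVec_apply (hf : G.Factorization A W B F)
    (hs : G.IsSeparation Z a b R P T) (hc : ∀ z ∈ Z, c z = 0) (hi : i ∈ G.compClosure R) :
    (W *ᵥ (G.compClosure R \ T).indicator (F *ᵥ c)) i =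
      ((W * F) *ᵥ (R \ P).indicator c) i := by
  have hW : (W *ᵥ (G.compClosure R \ T).indicator (F *ᵥ c)) i =
      Tᶜ.indicator (W *ᵥ (F *ᵥ c)) i := by
    refine mulVec_indicator_apply W _ fun j hj _ => ?_
    rw [Set.mem_sdiff, and_iff_right ((hf.linked hj).mem_compClosure_iff.1 hi)]
    rcases hf.line i j hj with rfl | h
    · rfl
    · exact not_congr (hs.comp_iff_of_line i j h).symm
  rw [hW, Matrix.mulVec_mulVec]
  refine (mulVec_indicator_apply _ _ fun f hfi hcf => ?_).symm
  have hsolid := hf.solid i f hfi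
  rw [Set.mem_sdiff, and_iff_right (hs.mem_of_solid f i hsolid hi), Set.mem_compl_iff,
    hs.comp_iff_of_solid f i hsolid (fun h => hcf (hc f h)) hi]

lemma mulVec_cutInnovation_apply (hf : G.Factorization A W B F)
    (hs : G.IsSeparation Z a b R P T) (hc : ∀ z ∈ Z, c z = 0) (hi : i ∈ G.compClosure R)
    (hib : i ∉ G.barrier Z) :
    (W *ᵥ G.cutInnovation R P T B F c) i = Pᶜ.indicator (W *ᵥ innovation B F c) i := by
  have hW : (W *ᵥ (G.compClosure R \ P).indicator (c - B *ᵥ c)) i =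
      Pᶜ.indicator (W *ᵥ (c - B *ᵥ c)) i := by
    refine mulVec_indicator_apply W _ fun j hj hcj => ?_
    rw [Set.mem_sdiff, and_iff_right ((hf.linked hj).mem_compClosure_iff.1 hi)]
    rcases hf.line i j hj with rfl | h
    · rfl
    · exact not_congr (hs.iff_of_line i j h hib
        fun hjb => hcj (hf.sub_mulVec_eq_zero_of_mem_barrier hc hjb)).symm
  have hWF : ((W * F) *ᵥ (R \ P).indicator c) i = Pᶜ.indicator ((W * F) *ᵥ c) i := by
    refine mulVec_indicator_apply _ _ fun f hfi hcf => ?_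
    have hsolid := hf.solid i f hfi
    rw [Set.mem_sdiff, and_iff_right (hs.mem_of_solid f i hsolid hi), Set.mem_compl_iff,
      hs.iff_of_solid f i hsolid (fun h => hcf (hc f h)) hi hib]
  rw [cutInnovation, innovation, Matrix.mulVec_sub, Matrix.mulVec_sub, Pi.sub_apply, hW,
    hf.mulVec_indicator_mulVec_apply hs hc hi, hWF, Set.indicator_sub', Pi.sub_apply,
    Matrix.mulVec_mulVec]

lemma mulVec_cutInnovation_eq_zero_of_notMem (hG : G.IsChainGraph)
    (hf : G.Factorization A W B F) (hs : G.IsSeparation Z a b R P T) (hγ : IsResidual A Z a γ)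
    (hi : i ∉ R) : (W *ᵥ G.cutInnovation R P T B F (A *ᵥ γ)) i = 0 := by
  by_cases hN : i ∈ G.compClosure R
  · rw [hf.mulVec_cutInnovation_apply hs hγ.orth hN fun h => hi (hs.subset h.1), Set.indicator,
      hf.mulVec_innovation_eq_zero_of_notMem hG hs hγ hi, ite_self]
  · refine Finset.sum_eq_zero fun j _ => ?_
    by_cases hj : W i j = 0
    · simp [hj]
    · have hjN : j ∉ G.compClosure R := mt (hf.linked hj).mem_compClosure_iff.2 hN
      simp [cutInnovation, hjN]

lemma indicator_sub_mulVec_apply (hf : G.Factorization A W B F)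
    (hs : G.IsSeparation Z a b R P T) (hc : ∀ z ∈ Z, c z = 0) (hi : i ∈ R) :
    (G.compClosure R \ P).indicator (c - B *ᵥ c) i =
      ((R \ P).indicator c - B *ᵥ (R \ P).indicator c) i := by
  have hB : (B *ᵥ (R \ P).indicator c) i = Pᶜ.indicator (B *ᵥ c) i := by
    refine mulVec_indicator_apply B c fun m hm hcm => ?_
    have hd := hf.dashed i m hm
    rw [Set.mem_sdiff, and_iff_right (hs.mem_of_dashed m i hd hi), Set.mem_compl_iff,
      hs.iff_of_dashed m i hd (fun h => hcm (hc m h)) hi]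
  rw [Pi.sub_apply, hB]
  by_cases hP : i ∈ P
  · simp [hP]
  · simp [hP, hi, subset_compClosure R hi]

lemma sub_transpose_mulVec_cutInnovation_eq_zero (hG : G.IsChainGraph)
    (hf : G.Factorization A W B F) (hs : G.IsSeparation Z a b R P T) (hγ : IsResidual A Z a γ)
    (hj : j ∈ R \ P) (hjZ : j ∉ Z) :
    (W *ᵥ G.cutInnovation R P T B F (A *ᵥ γ) -
      Bᵀ *ᵥ (W *ᵥ G.cutInnovation R P T B F (A *ᵥ γ)) -
      (W * F)ᵀ *ᵥ G.cutInnovation R P T B F (A *ᵥ γ)) j = 0 := by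
  have hW : (W *ᵥ G.cutInnovation R P T B F (A *ᵥ γ)) j =
      (W *ᵥ innovation B F (A *ᵥ γ)) j := by
    rw [hf.mulVec_cutInnovation_apply hs hγ.orth (subset_compClosure R hj.1) fun h => hjZ h.1,
      Set.indicator_of_mem hj.2]
  have hB : (Bᵀ *ᵥ (W *ᵥ G.cutInnovation R P T B F (A *ᵥ γ))) j =
      (Bᵀ *ᵥ (W *ᵥ innovation B F (A *ᵥ γ))) j := Finset.sum_congr rfl fun i _ => by
    by_cases hij : B i j = 0
    · simp [hij]
    have hd := hf.dashed i j hij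
    by_cases hi : i ∈ R
    · rw [hf.mulVec_cutInnovation_apply hs hγ.orth (subset_compClosure R hi)
        fun h => hjZ (h.2 j hd), Set.indicator_of_mem (mt (hs.iff_of_dashed j i hd hjZ hi).2 hj.2)]
    · rw [hf.mulVec_cutInnovation_eq_zero_of_notMem hG hs hγ hi,
        hf.mulVec_innovation_eq_zero_of_notMem hG hs hγ hi]
  have hF : ((W * F)ᵀ *ᵥ G.cutInnovation R P T B F (A *ᵥ γ)) j =
      ((W * F)ᵀ *ᵥ innovation B F (A *ᵥ γ)) j := Finset.sum_congr rfl fun i _ => by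
    by_cases hij : (W * F) i j = 0
    · simp [hij]
    have hsolid := hf.solid i j hij
    congr 1
    by_cases hi : i ∈ G.compClosure R
    · have hT : i ∉ T := mt (hs.comp_iff_of_solid j i hsolid hjZ hi).2 hj.2
      rw [cutInnovation, innovation, Pi.sub_apply, Pi.sub_apply _ (F *ᵥ _),
        Set.indicator_of_mem (show i ∈ G.compClosure R \ T from ⟨hi, hT⟩)]
      by_cases hib : i ∈ G.barrier Z
      · rw [Set.indicator, hf.sub_mulVec_eq_zero_of_mem_barrier hγ.orth hib, ite_self]
      · rw [Set.indicator_of_mem (show i ∈ G.compClosure R \ P from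
          ⟨hi, mt (hs.iff_of_solid j i hsolid hjZ hi hib).2 hj.2⟩)]
    · rw [hf.innovation_eq_zero_of_notMem hG hs hγ hi]
      simp [cutInnovation, hi]
  rw [Pi.sub_apply, Pi.sub_apply, hW, hB, hF, hf.transpose_mul_mulVec,
    hf.mulVec_innovation_apply_eq hγ hjZ fun h => hj.2 (h ▸ hs.left_mem.2)]
  ring

lemma cutInnovation_dotProduct_mulVec (hG : G.IsChainGraph) (hf : G.Factorization A W B F)
    (hs : G.IsSeparation Z a b R P T) (hγ : IsResidual A Z a γ) :
    G.cutInnovation R P T B F (A *ᵥ γ) ⬝ᵥ W *ᵥ G.cutInnovation R P T B F (A *ᵥ γ) =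
      (R \ P).indicator (A *ᵥ γ) ⬝ᵥ (W *ᵥ G.cutInnovation R P T B F (A *ᵥ γ) -
        Bᵀ *ᵥ (W *ᵥ G.cutInnovation R P T B F (A *ᵥ γ)) -
        (W * F)ᵀ *ᵥ G.cutInnovation R P T B F (A *ᵥ γ)) := by
  set d := (R \ P).indicator (A *ᵥ γ)
  set y := G.cutInnovation R P T B F (A *ᵥ γ) with hy
  have hnode : (G.compClosure R \ P).indicator (A *ᵥ γ - B *ᵥ (A *ᵥ γ)) ⬝ᵥ W *ᵥ y =
      (d - B *ᵥ d) ⬝ᵥ W *ᵥ y := Finset.sum_congr rfl fun i _ => by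
    by_cases hi : i ∈ R
    · rw [hf.indicator_sub_mulVec_apply hs hγ.orth hi]
    · rw [hf.mulVec_cutInnovation_eq_zero_of_notMem hG hs hγ hi, mul_zero, mul_zero]
  have hcomp : (G.compClosure R \ T).indicator (F *ᵥ (A *ᵥ γ)) ⬝ᵥ W *ᵥ y =
      y ⬝ᵥ (W * F) *ᵥ d := by
    rw [dotProduct_mulVec_comm_of_isSymm hf.isSymm]
    refine Finset.sum_congr rfl fun i _ => ?_
    by_cases hi : i ∈ G.compClosure R
    · rw [hf.mulVec_indicator_mulVec_apply hs hγ.orth hi]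
    · simp [hy, cutInnovation, hi]
  have hsplit : y ⬝ᵥ W *ᵥ y = (d - B *ᵥ d) ⬝ᵥ W *ᵥ y - y ⬝ᵥ (W * F) *ᵥ d := by
    rw [← hnode, ← hcomp, ← sub_dotProduct, hy, cutInnovation]
  rw [hsplit, sub_dotProduct, dotProduct_comm (B *ᵥ d), dotProduct_sub, dotProduct_sub,
    Matrix.dotProduct_transpose_mulVec, Matrix.dotProduct_transpose_mulVec]

lemma cutInnovation_eq_zero (hG : G.IsChainGraph) (hf : G.Factorization A W B F)
    (hs : G.IsSeparation Z a b R P T) (hγ : IsResidual A Z a γ) :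
    G.cutInnovation R P T B F (A *ᵥ γ) = 0 := by
  by_contra hne
  refine (hf.posDef.dotProduct_mulVec_pos hne).ne' ?_
  rw [star_trivial, hf.cutInnovation_dotProduct_mulVec hG hs hγ]
  refine Finset.sum_eq_zero fun j _ => ?_
  by_cases hj : j ∈ R \ P
  · by_cases hjZ : j ∈ Z
    · rw [Set.indicator_of_mem hj, hγ.orth j hjZ, zero_mul]
    · rw [hf.sub_transpose_mulVec_cutInnovation_eq_zero hG hs hγ hj hjZ, mul_zero]
  · rw [Set.indicator_of_notMem hj, zero_mul]

lemma indicator_mulVec_eq_zero (hG : G.IsChainGraph) (hf : G.Factorization A W B F)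
    (hs : G.IsSeparation Z a b R P T) (hγ : IsResidual A Z a γ) (hi : i ∈ R) :
    (R \ P).indicator (A *ᵥ γ) i = 0 := by
  set d := (R \ P).indicator (A *ᵥ γ)
  set u := (G.compClosure R \ P).indicator (A *ᵥ γ - B *ᵥ (A *ᵥ γ))
  have hu : u = (G.compClosure R \ T).indicator (F *ᵥ (A *ᵥ γ)) :=
    sub_eq_zero.1 (hf.cutInnovation_eq_zero hG hs hγ)
  have := hG.isStrictOrder
  induction i using (Finite.wellFounded_of_trans_of_irrefl G.StrictDesc).induction with
  | _ i ih =>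
    have hB : (B *ᵥ d) i = 0 := Finset.sum_eq_zero fun m _ => by
      by_cases hm : B i m = 0
      · simp [hm]
      · have hd := hf.dashed i m hm
        rw [ih m (.of_arrow (Or.inr hd)) (hs.mem_of_dashed m i hd hi), mul_zero]
    have hzero : (G.comp i).indicator u = 0 := by
      refine eq_zero_of_posDef_of_forall_mulVec_eq_zero hf.posDef (S := G.comp i)
        (fun j hj => Set.indicator_of_notMem hj _) fun j hij => ?_
      have hjN : j ∈ G.compClosure R := ⟨i, hi, Linked.symm hij⟩
      rw [mulVec_indicator_apply (S := G.comp i) (S' := Set.univ) W u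
        fun k hk _ => iff_of_true (Linked.trans hij (hf.linked hk)) trivial, Set.indicator_univ, hu,
        hf.mulVec_indicator_mulVec_apply hs hγ.orth hjN]
      refine Finset.sum_eq_zero fun f _ => ?_
      by_cases hfj : (W * F) j f = 0
      · simp [hfj]
      · have hsolid := hf.solid j f hfj
        have hdf : d f = 0 :=
          ih f ((StrictDesc.of_arrow (Or.inl hsolid)).trans_steps (Linked.symm hij).steps)
            (hs.mem_of_solid f j hsolid hjN)
        exact mul_eq_zero_of_right _ hdf
    have hui : u i = 0 := by
      rw [← Set.indicator_of_mem (mem_comp_self i) u, hzero, Pi.zero_apply]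
    have hdi := hf.indicator_sub_mulVec_apply hs hγ.orth hi
    rw [Pi.sub_apply, hB, sub_zero] at hdi
    exact hdi.symm.trans hui

lemma mulVec_eq_zero_of_isSeparation (hG : G.IsChainGraph) (hf : G.Factorization A W B F)
    (hs : G.IsSeparation Z a b R P T) (hγ : IsResidual A Z a γ) : (A *ᵥ γ) b = 0 := by
  rw [← Set.indicator_of_mem hs.right_mem (A *ᵥ γ),
    hf.indicator_mulVec_eq_zero hG hs hγ hs.right_mem.1]

end Factorization

end MixedGraph

/-! ### Marks, colliders and open routes -/

namespace MixedGraph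

variable {V : Type*} {G : MixedGraph V} {Z : Set V} {x y z : V}

/-- The possible marks of an edge at one of its ends, see `MixedGraph.Mark.At`. -/
inductive Mark
  | tail
  | line
  | solid
  | dashed

/-- The edge between `x` and `y` has the given mark at `y`: it leaves `y` (`tail`), is undirected
(`line`), or enters `y` as a solid or a dashed arrow. -/
def Mark.At (G : MixedGraph V) : Mark → V → V → Prop
  | .tail, x, y => G.Arrow y x
  | .line, x, y => G.line x y
  | .solid, x, y => G.solid x y
  | .dashed, x, y => G.dashed x y

namespace Mark.At

variable {m : Mark}

lemma tail_eq (h : m.At G x y) (h' : G.Arrow y x) : m = .tail := by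
  cases m
  · rfl
  · rcases h' with h' | h'
    · exact absurd ⟨G.line_symm _ _ h, h'⟩ (G.not_line_solid y x)
    · exact absurd ⟨G.line_symm _ _ h, h'⟩ (G.not_line_dashed y x)
  · rcases h' with h' | h'
    · exact absurd ⟨h, h'⟩ (G.not_solid_solid x y)
    · exact absurd ⟨h, h'⟩ (G.not_solid_dashed_rev x y)
  · rcases h' with h' | h'
    · exact absurd ⟨h', h⟩ (G.not_solid_dashed_rev y x)
    · exact absurd ⟨h, h'⟩ (G.not_dashed_dashed x y)

lemma line_eq (h : m.At G x y) (h' : G.line x y) : m = .line := by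
  cases m
  · exact absurd (tail_eq (m := .line) h' h) (by simp)
  · rfl
  · exact absurd ⟨h', h⟩ (G.not_line_solid x y)
  · exact absurd ⟨h', h⟩ (G.not_line_dashed x y)

lemma solid_eq (h : m.At G x y) (h' : G.solid x y) : m = .solid := by
  cases m
  · exact absurd (tail_eq (m := .solid) h' h) (by simp)
  · exact absurd ⟨h, h'⟩ (G.not_line_solid x y)
  · rfl
  · exact absurd ⟨h', h⟩ (G.not_solid_dashed x y)

lemma dashed_eq (h : m.At G x y) (h' : G.dashed x y) : m = .dashed := by
  cases m
  · exact absurd (tail_eq (m := .dashed) h' h) (by simp)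
  · exact absurd ⟨h, h'⟩ (G.not_line_dashed x y)
  · exact absurd ⟨h, h'⟩ (G.not_solid_dashed x y)
  · rfl

lemma dashed_and_iff {n : Mark} (hm : m.At G x y) (hn : n.At G z y) :
    (G.dashed x y ∧ (G.dashed z y ∨ G.line y z ∨ G.solid z y)) ↔ m = .dashed ∧ n ≠ .tail := by
  constructor
  · rintro ⟨hd, h⟩
    refine ⟨hm.dashed_eq hd, ?_⟩
    rcases h with h | h | h
    · simp [hn.dashed_eq h]
    · simp [hn.line_eq (G.line_symm _ _ h)]
    · simp [hn.solid_eq h]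
  · rintro ⟨rfl, hn'⟩
    refine ⟨hm, ?_⟩
    cases n
    · exact absurd rfl hn'
    · exact Or.inr (Or.inl (G.line_symm _ _ hn))
    · exact Or.inr (Or.inr hn)
    · exact Or.inl hn

end Mark.At

lemma arrow_or_line_or_arrow_of_adj (h : G.skeleton.Adj x y) :
    G.Arrow x y ∨ G.line x y ∨ G.Arrow y x := by
  rcases h with (h | h) | (h | h)
  · exact Or.inl h
  · exact Or.inr (Or.inl h)
  · exact Or.inr (Or.inr h)
  · exact Or.inr (Or.inl (G.line_symm _ _ h))

lemma exists_mark_at (h : G.skeleton.Adj x y) : ∃ m : Mark, m.At G x y := by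
  rcases arrow_or_line_or_arrow_of_adj h with (h | h) | h | h
  · exact ⟨.solid, h⟩
  · exact ⟨.dashed, h⟩
  · exact ⟨.line, h⟩
  · exact ⟨.tail, h⟩

section Collider

variable {ρ : G.skeleton.Walk x y} {k s t : ℕ} {m n : Mark}

lemma exists_marks_at (h0 : 0 < k) (hk : k < ρ.length) :
    ∃ m n : Mark, m.At G (ρ.getVert (k - 1)) (ρ.getVert k) ∧
      n.At G (ρ.getVert (k + 1)) (ρ.getVert k) := by
  have h := ρ.adj_getVert_succ (i := k - 1) (by omega)
  rw [Nat.sub_add_cancel h0] at h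
  obtain ⟨m, hm⟩ := exists_mark_at h
  obtain ⟨n, hn⟩ := exists_mark_at (ρ.adj_getVert_succ hk).symm
  exact ⟨m, n, hm, hn⟩

lemma isColliderNode_iff_of_at (h0 : 0 < k) (hk : k < ρ.length)
    (hm : m.At G (ρ.getVert (k - 1)) (ρ.getVert k))
    (hn : n.At G (ρ.getVert (k + 1)) (ρ.getVert k)) :
    IsColliderNode ρ k ↔ m ≠ .tail ∧ n ≠ .tail ∧ (m = .dashed ∨ n = .dashed) := by
  rw [IsColliderNode, hm.dashed_and_iff hn, hn.dashed_and_iff hm]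
  constructor
  · rintro ⟨-, -, ⟨rfl, h⟩ | ⟨rfl, h⟩⟩
    · exact ⟨by simp, h, Or.inl rfl⟩
    · exact ⟨h, by simp, Or.inr rfl⟩
  · rintro ⟨hm', hn', rfl | rfl⟩
    · exact ⟨h0, hk, Or.inl ⟨rfl, hn'⟩⟩
    · exact ⟨h0, hk, Or.inr ⟨rfl, hm'⟩⟩

lemma IsColliderSection.at_prev (h : IsColliderSection ρ s t) (hs : s ≤ k) (ht : k ≤ t)
    (hm : m.At G (ρ.getVert (k - 1)) (ρ.getVert k)) : m = .line ∨ m = .solid := by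
  obtain ⟨h0, -, -, hsolid, hline, -⟩ := h
  rcases hs.eq_or_lt with rfl | hs
  · exact Or.inr (hm.solid_eq hsolid)
  · have hl := hline (k - 1) (by omega) (by omega)
    rw [Nat.sub_add_cancel (by omega)] at hl
    exact Or.inl (hm.line_eq hl)

lemma IsColliderSection.at_next (h : IsColliderSection ρ s t) (hs : s ≤ k) (ht : k ≤ t)
    (hm : m.At G (ρ.getVert (k + 1)) (ρ.getVert k)) : m = .line ∨ m = .solid := by
  obtain ⟨-, -, -, -, hline, hsolid⟩ := h
  rcases ht.eq_or_lt with rfl | ht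
  · exact Or.inr (hm.solid_eq hsolid)
  · exact Or.inl (hm.line_eq (G.line_symm _ _ (hline k hs ht)))

lemma IsColliderSection.not_isColliderNode (h : IsColliderSection ρ s t) (hs : s ≤ k)
    (ht : k ≤ t) : ¬ IsColliderNode ρ k := by
  intro hc
  obtain ⟨m, n, hm, hn⟩ := exists_marks_at hc.1 hc.2.1
  have hd := ((isColliderNode_iff_of_at hc.1 hc.2.1 hm hn).1 hc).2.2
  rcases h.at_prev hs ht hm with rfl | rfl <;> rcases h.at_next hs ht hn with rfl | rfl <;>
    simp at hd

end Collider

section Append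

variable (ρ : G.skeleton.Walk x y) (σ : G.skeleton.Walk y z) {s t k : ℕ}

lemma getVert_append_left (hk : k ≤ ρ.length) : (ρ.append σ).getVert k = ρ.getVert k := by
  rw [SimpleGraph.Walk.getVert_append', if_pos hk]

lemma getVert_append_right (k : ℕ) : (ρ.append σ).getVert (ρ.length + k) = σ.getVert k := by
  rw [SimpleGraph.Walk.getVert_append, if_neg (by omega), Nat.add_sub_cancel_left]

lemma isColliderSection_append_left (ht : t < ρ.length) :
    IsColliderSection (ρ.append σ) s t ↔ IsColliderSection ρ s t := by
  by_cases hst : s ≤ t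
  · rw [IsColliderSection, IsColliderSection, SimpleGraph.Walk.length_append,
      getVert_append_left ρ σ (by omega : s - 1 ≤ _), getVert_append_left ρ σ (by omega : s ≤ _),
      getVert_append_left ρ σ (by omega : t + 1 ≤ _), getVert_append_left ρ σ ht.le]
    refine and_congr_right fun _ => and_congr_right fun _ => and_congr (by omega) <|
      and_congr_right fun _ => and_congr_left fun _ => forall₃_congr fun k _ hk => ?_
    rw [getVert_append_left ρ σ (by omega : k ≤ _), getVert_append_left ρ σ (by omega : k + 1 ≤ _)]
  · exact iff_of_false (fun h => hst h.2.1) fun h => hst h.2.1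

lemma isColliderSection_append_right (hs : 0 < s) :
    IsColliderSection (ρ.append σ) (ρ.length + s) (ρ.length + t) ↔ IsColliderSection σ s t := by
  rw [IsColliderSection, IsColliderSection, Nat.add_sub_assoc (by omega), add_assoc,
    getVert_append_right, getVert_append_right, getVert_append_right, getVert_append_right,
    SimpleGraph.Walk.length_append]
  refine and_congr (by omega) (and_congr (by omega) (and_congr (by omega) (and_congr_right fun _ =>
    and_congr_left fun _ => ⟨fun h k hsk hkt => ?_, fun h k hsk hkt => ?_⟩)))
  · simpa only [add_assoc, getVert_append_right] using h (ρ.length + k) (by omega) (by omega)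
  · obtain ⟨l, rfl⟩ := Nat.exists_eq_add_of_le (by omega : ρ.length ≤ k)
    rw [add_assoc, getVert_append_right, getVert_append_right]
    exact h l (by omega) (by omega)

lemma isColliderNode_append_left (hk : k < ρ.length) :
    IsColliderNode (ρ.append σ) k ↔ IsColliderNode ρ k := by
  rw [IsColliderNode, IsColliderNode, getVert_append_left ρ σ (by omega : k - 1 ≤ _),
    getVert_append_left ρ σ hk.le, getVert_append_left ρ σ (by omega : k + 1 ≤ _),
    SimpleGraph.Walk.length_append]
  exact and_congr_right fun _ => and_congr_left fun _ => by omega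

lemma isColliderNode_append_right (hk : 0 < k) :
    IsColliderNode (ρ.append σ) (ρ.length + k) ↔ IsColliderNode σ k := by
  rw [IsColliderNode, IsColliderNode, Nat.add_sub_assoc (by omega), add_assoc,
    getVert_append_right, getVert_append_right, getVert_append_right,
    SimpleGraph.Walk.length_append]
  exact and_congr (by omega) (and_congr_left fun _ => by omega)

end Append

section Reverse

variable {ρ : G.skeleton.Walk x y} {s t k : ℕ}

lemma IsColliderNode.reverse (h : IsColliderNode ρ k) :
    IsColliderNode ρ.reverse (ρ.length - k) := by
  obtain ⟨h0, hk, h⟩ := h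
  refine ⟨by omega, by rw [SimpleGraph.Walk.length_reverse]; omega, ?_⟩
  rw [SimpleGraph.Walk.getVert_reverse, SimpleGraph.Walk.getVert_reverse,
    SimpleGraph.Walk.getVert_reverse, Nat.sub_sub_self hk.le,
    show ρ.length - (ρ.length - k - 1) = k + 1 by omega,
    show ρ.length - (ρ.length - k + 1) = k - 1 by omega]
  exact h.symm

lemma IsColliderSection.reverse (h : IsColliderSection ρ s t) :
    IsColliderSection ρ.reverse (ρ.length - t) (ρ.length - s) := by
  obtain ⟨h0, hst, ht, hs, hline, ht'⟩ := h
  refine ⟨by omega, by omega, by rw [SimpleGraph.Walk.length_reverse]; omega, ?_,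
    fun k hk hk' => ?_, ?_⟩
  · rwa [SimpleGraph.Walk.getVert_reverse, SimpleGraph.Walk.getVert_reverse,
      show ρ.length - (ρ.length - t - 1) = t + 1 by omega, Nat.sub_sub_self (by omega)]
  · have hl := hline (ρ.length - (k + 1)) (by omega) (by omega)
    rw [show ρ.length - (k + 1) + 1 = ρ.length - k by omega] at hl
    rw [SimpleGraph.Walk.getVert_reverse, SimpleGraph.Walk.getVert_reverse]
    exact G.line_symm _ _ hl
  · rwa [SimpleGraph.Walk.getVert_reverse, SimpleGraph.Walk.getVert_reverse,
      show ρ.length - (ρ.length - s + 1) = s - 1 by omega, Nat.sub_sub_self (by omega)]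

end Reverse

/-- The interior occurrences of the route `ρ` satisfy the conditions for being `Z`-open. Unlike
`MixedGraph.IsOpenRoute`, this allows the ends of `ρ` to be in `Z`, so that routes can be joined. -/
structure PreOpen (Z : Set V) (ρ : G.skeleton.Walk x y) : Prop where
  collider_node : ∀ k, IsColliderNode ρ k → ρ.getVert k ∈ Z
  collider_section : ∀ s t, IsColliderSection ρ s t → ∃ k, s ≤ k ∧ k ≤ t ∧ ρ.getVert k ∈ Z
  other : ∀ k, 0 < k → k < ρ.length → ¬ IsColliderNode ρ k →
    (¬ ∃ s t, IsColliderSection ρ s t ∧ s ≤ k ∧ k ≤ t) → ρ.getVert k ∉ Z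

namespace PreOpen

lemma isOpenRoute {ρ : G.skeleton.Walk x y} (h : PreOpen Z ρ) (hx : x ∉ Z) (hy : y ∉ Z) :
    IsOpenRoute Z ρ := by
  refine ⟨h.collider_node, h.collider_section, fun k hk hc hs => ?_⟩
  rcases Nat.eq_zero_or_pos k with rfl | h0
  · rwa [SimpleGraph.Walk.getVert_zero]
  rcases hk.eq_or_lt with rfl | hk
  · rwa [SimpleGraph.Walk.getVert_length]
  exact h.other k h0 hk hc hs

lemma reverse {ρ : G.skeleton.Walk x y} (h : PreOpen Z ρ) : PreOpen Z ρ.reverse := by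
  have hlen := ρ.length_reverse
  have hvert : ∀ k, ρ.reverse.getVert k = ρ.getVert (ρ.length - k) := ρ.getVert_reverse
  refine ⟨fun k hk => ?_, fun s t hst => ?_, fun k h0 hk hc hs => ?_⟩
  · have hk' := hk.reverse
    rw [SimpleGraph.Walk.reverse_reverse, hlen] at hk'
    rw [hvert]
    exact h.collider_node _ hk'
  · have hst' := hst.reverse
    rw [SimpleGraph.Walk.reverse_reverse, hlen] at hst'
    obtain ⟨k, htk, hks, hkZ⟩ := h.collider_section _ _ hst'
    have := hst.2.1
    have := hst.2.2.1
    exact ⟨ρ.length - k, by omega, by omega, by rwa [hvert, Nat.sub_sub_self (by omega)]⟩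
  · rw [hlen] at hk
    rw [hvert]
    refine h.other _ (by omega) (by omega) (fun hc' => hc ?_) ?_
    · simpa only [Nat.sub_sub_self hk.le] using hc'.reverse
    · rintro ⟨s, t, hst, hsk, hkt⟩
      exact hs ⟨_, _, hst.reverse, by omega, by omega⟩

lemma append {ρ : G.skeleton.Walk x y} {σ : G.skeleton.Walk y z} (hρ : PreOpen Z ρ)
    (hσ : PreOpen Z σ) (hy : IsColliderNode (ρ.append σ) ρ.length ↔ y ∈ Z)
    (hsec : ∀ s t, IsColliderSection (ρ.append σ) s t → s ≤ ρ.length → t < ρ.length) :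
    PreOpen Z (ρ.append σ) := by
  have hvert : (ρ.append σ).getVert ρ.length = y := by
    rw [getVert_append_left ρ σ le_rfl, SimpleGraph.Walk.getVert_length]
  refine ⟨fun k hk => ?_, fun s t hst => ?_, fun k h0 hk hc hs => ?_⟩
  · rcases lt_trichotomy k ρ.length with hlt | rfl | hlt
    · rw [getVert_append_left ρ σ hlt.le]
      exact hρ.collider_node k ((isColliderNode_append_left ρ σ hlt).1 hk)
    · exact hvert.symm ▸ hy.1 hk
    · obtain ⟨l, rfl⟩ := Nat.exists_eq_add_of_le hlt.le
      rw [getVert_append_right]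
      exact hσ.collider_node l ((isColliderNode_append_right ρ σ (by omega)).1 hk)
  · have := hst.2.1
    rcases lt_or_ge t ρ.length with ht | ht
    · obtain ⟨k, hsk, hkt, hkZ⟩ := hρ.collider_section s t
        ((isColliderSection_append_left ρ σ ht).1 hst)
      exact ⟨k, hsk, hkt, by rwa [getVert_append_left ρ σ (by omega)]⟩
    · have hs : ρ.length < s := not_le.1 fun hs => ht.not_gt (hsec s t hst hs)
      obtain ⟨s', rfl⟩ := Nat.exists_eq_add_of_le hs.le
      obtain ⟨t', rfl⟩ := Nat.exists_eq_add_of_le ht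
      obtain ⟨k, hsk, hkt, hkZ⟩ := hσ.collider_section s' t'
        ((isColliderSection_append_right ρ σ (by omega)).1 hst)
      exact ⟨ρ.length + k, by omega, by omega, by rwa [getVert_append_right]⟩
  · rcases lt_trichotomy k ρ.length with hlt | rfl | hlt
    · rw [getVert_append_left ρ σ hlt.le]
      refine hρ.other k h0 hlt (mt (isColliderNode_append_left ρ σ hlt).2 hc) ?_
      rintro ⟨s, t, hst, hsk, hkt⟩
      exact hs ⟨s, t, (isColliderSection_append_left ρ σ hst.2.2.1).2 hst, hsk, hkt⟩
    · exact hvert.symm ▸ mt hy.2 hc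
    · obtain ⟨l, rfl⟩ := Nat.exists_eq_add_of_le hlt.le
      rw [SimpleGraph.Walk.length_append] at hk
      rw [getVert_append_right]
      refine hσ.other l (by omega) (by omega)
        (mt (isColliderNode_append_right ρ σ (by omega)).2 hc) ?_
      rintro ⟨s, t, hst, hsk, hkt⟩
      exact hs ⟨_, _, (isColliderSection_append_right ρ σ hst.1).2 hst, by omega, by omega⟩

end PreOpen

/-- There is a route of positive length from `x` to `y` with `Z`-open interior whose first edge has
mark `m` at `x` and whose last edge has mark `n` at `y`. -/
def OpenVia (G : MixedGraph V) (Z : Set V) (m : Mark) (x y : V) (n : Mark) : Prop :=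
  ∃ ρ : G.skeleton.Walk x y, 0 < ρ.length ∧ PreOpen Z ρ ∧ m.At G (ρ.getVert 1) x ∧
    n.At G (ρ.getVert (ρ.length - 1)) y

namespace OpenVia

variable {m n m' n' : Mark}

lemma symm (h : G.OpenVia Z m x y n) : G.OpenVia Z n y x m := by
  obtain ⟨ρ, h0, hopen, hm, hn⟩ := h
  refine ⟨ρ.reverse, by rwa [SimpleGraph.Walk.length_reverse], hopen.reverse, ?_, ?_⟩
  · rwa [SimpleGraph.Walk.getVert_reverse]
  · rwa [SimpleGraph.Walk.getVert_reverse, SimpleGraph.Walk.length_reverse,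
      Nat.sub_sub_self (by omega)]

lemma join (h : G.OpenVia Z m x y n) (h' : G.OpenVia Z m' y z n')
    (hy : y ∉ Z ∧ (n = .tail ∨ m' = .tail) ∨
      y ∈ Z ∧ n ≠ .tail ∧ m' ≠ .tail ∧ (n = .dashed ∨ m' = .dashed)) :
    G.OpenVia Z m x z n' := by
  obtain ⟨ρ, hρ, oρ, hm, hn⟩ := h
  obtain ⟨σ, hσ, oσ, hm', hn'⟩ := h'
  have hlen : (ρ.append σ).length = ρ.length + σ.length := SimpleGraph.Walk.length_append _ _
  have hvert : (ρ.append σ).getVert ρ.length = y := by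
    rw [getVert_append_left ρ σ le_rfl, SimpleGraph.Walk.getVert_length]
  have hprev : n.At G ((ρ.append σ).getVert (ρ.length - 1)) ((ρ.append σ).getVert ρ.length) := by
    rwa [hvert, getVert_append_left ρ σ (by omega)]
  have hnext : m'.At G ((ρ.append σ).getVert (ρ.length + 1)) ((ρ.append σ).getVert ρ.length) := by
    rwa [hvert, getVert_append_right]
  refine ⟨ρ.append σ, by omega, oρ.append oσ ?_ fun s t hst hs => ?_, ?_, ?_⟩
  · rw [isColliderNode_iff_of_at hρ (by omega) hprev hnext]
    rcases hy with ⟨hy, rfl | rfl⟩ | ⟨hy, hc⟩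
    · simp [hy]
    · simp [hy]
    · exact iff_of_true hc hy
  · by_contra! ht
    have hn_eq := hst.at_prev hs ht hprev
    have hm_eq := hst.at_next hs ht hnext
    rcases hy with ⟨-, rfl | rfl⟩ | ⟨-, -, -, rfl | rfl⟩ <;> simp at hn_eq hm_eq
  · rwa [getVert_append_left ρ σ (by omega)]
  · rwa [hlen, Nat.add_sub_assoc (by omega), getVert_append_right]

end OpenVia

end MixedGraph

/-! ### Joining open routes through undirected edges -/

namespace MixedGraph

variable {V : Type*} {G : MixedGraph V} {Z : Set V} {f f' x y z : V}

lemma skeleton_adj_of_line (h : G.line x y) : G.skeleton.Adj x y := Or.inl (Or.inr h)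

lemma skeleton_adj_of_arrow (h : G.Arrow x y) : G.skeleton.Adj x y := Or.inl (Or.inl h)

/-- All edges of the route `ρ` are undirected. -/
def IsUndirected (ρ : G.skeleton.Walk x y) : Prop :=
  ∀ k < ρ.length, G.line (ρ.getVert k) (ρ.getVert (k + 1))

lemma isUndirected_nil (x : V) : IsUndirected (.nil : G.skeleton.Walk x x) :=
  fun k hk => absurd hk (Nat.not_lt_zero k)

lemma IsUndirected.cons {ρ : G.skeleton.Walk y z} (hρ : IsUndirected ρ) (h : G.line x y) :
    IsUndirected (.cons (skeleton_adj_of_line h) ρ) := by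
  rintro (- | k) hk
  · simpa using h
  · simpa using hρ k (by simpa using hk)

lemma IsUndirected.append {ρ : G.skeleton.Walk x y} {σ : G.skeleton.Walk y z}
    (hρ : IsUndirected ρ) (hσ : IsUndirected σ) : IsUndirected (ρ.append σ) := by
  intro k hk
  rw [SimpleGraph.Walk.length_append] at hk
  by_cases hk' : k < ρ.length
  · rw [getVert_append_left _ _ hk'.le, getVert_append_left _ _ hk']
    exact hρ k hk'
  · obtain ⟨l, rfl⟩ := Nat.exists_eq_add_of_le (not_lt.1 hk')
    rw [add_assoc, getVert_append_right, getVert_append_right]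
    exact hσ l (by omega)

lemma Linked.exists_isUndirected (h : G.Linked x y) :
    ∃ ρ : G.skeleton.Walk x y, IsUndirected ρ := by
  induction h using Relation.ReflTransGen.head_induction_on with
  | refl => exact ⟨.nil, isUndirected_nil y⟩
  | head h _ ih =>
    obtain ⟨ρ, hρ⟩ := ih
    exact ⟨_, hρ.cons h⟩

/-- `x` and `y` are joined by an undirected route all of whose nodes but possibly the first one are
outside `Z`. -/
def LinkedOff (G : MixedGraph V) (Z : Set V) (x y : V) : Prop :=
  Relation.ReflTransGen (fun u v => G.line u v ∧ v ∉ Z) x y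

namespace LinkedOff

lemma linked (h : G.LinkedOff Z x y) : G.Linked x y :=
  Relation.ReflTransGen.mono (fun _ _ h => h.1) _ _ h

lemma notMem (h : G.LinkedOff Z x y) (hx : x ∉ Z) : y ∉ Z := by
  cases h with
  | refl => exact hx
  | tail _ h => exact h.2

lemma symm (h : G.LinkedOff Z x y) (hx : x ∉ Z) : G.LinkedOff Z y x := by
  induction h with
  | refl => exact .refl
  | tail h hl ih => exact .head ⟨G.line_symm _ _ hl.1, notMem h hx⟩ ih

end LinkedOff

lemma Linked.linkedOff (h : G.Linked x y) (hZ : ∀ z ∈ Z, ¬ G.Linked x z) : G.LinkedOff Z x y := by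
  induction h with
  | refl => exact .refl
  | tail h hl ih => exact ih.tail ⟨hl, fun hz => hZ _ hz (Relation.ReflTransGen.tail h hl)⟩

lemma getVert_cons_notMem {ρ : G.skeleton.Walk y z} (h : G.skeleton.Adj x y) (hy : y ∉ Z)
    (hρ : ∀ k, 0 < k → k < ρ.length → ρ.getVert k ∉ Z) :
    ∀ k, 0 < k → k < (SimpleGraph.Walk.cons h ρ).length →
      (SimpleGraph.Walk.cons h ρ).getVert k ∉ Z := by
  rintro (- | - | k) h0 hk
  · exact absurd h0 (lt_irrefl 0)
  · simpa using hy
  · simpa using hρ (k + 1) k.succ_pos (by simpa using hk)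

lemma LinkedOff.exists_isUndirected (h : G.LinkedOff Z x y) (h' : G.line y z) :
    ∃ ρ : G.skeleton.Walk x z, 0 < ρ.length ∧ IsUndirected ρ ∧
      ∀ k, 0 < k → k < ρ.length → ρ.getVert k ∉ Z := by
  induction h using Relation.ReflTransGen.head_induction_on with
  | refl =>
    refine ⟨.cons (skeleton_adj_of_line h') .nil, by simp, ?_, fun k h0 hk => ?_⟩
    · exact (isUndirected_nil z).cons h'
    · rw [SimpleGraph.Walk.length_cons, SimpleGraph.Walk.length_nil] at hk
      omega
  | head h _ ih =>
    obtain ⟨ρ, -, hρ, hZ⟩ := ih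
    exact ⟨.cons (skeleton_adj_of_line h.1) ρ, by simp, hρ.cons h.1,
      getVert_cons_notMem _ h.2 hZ⟩

lemma preOpen_of_forall_line_or_solid {ρ : G.skeleton.Walk x y}
    (h : ∀ k < ρ.length, G.line (ρ.getVert k) (ρ.getVert (k + 1)) ∨
      G.solid (ρ.getVert k) (ρ.getVert (k + 1)))
    (hZ : ∀ k, 0 < k → k < ρ.length → ρ.getVert k ∉ Z) : PreOpen Z ρ := by
  refine ⟨fun k ⟨h0, hk, hc⟩ => ?_, fun s t ⟨_, _, ht, _, _, hsolid⟩ => ?_,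
    fun k h0 hk _ _ => hZ k h0 hk⟩
  · have hprev := h (k - 1) (by omega)
    rw [Nat.sub_add_cancel h0] at hprev
    rcases hc with ⟨hd, -⟩ | ⟨hd, -⟩
    · rcases hprev with h' | h'
      · exact absurd ⟨h', hd⟩ (G.not_line_dashed _ _)
      · exact absurd ⟨h', hd⟩ (G.not_solid_dashed _ _)
    · rcases h k hk with h' | h'
      · exact absurd ⟨G.line_symm _ _ h', hd⟩ (G.not_line_dashed _ _)
      · exact absurd ⟨h', hd⟩ (G.not_solid_dashed_rev _ _)
  · rcases h t ht with h' | h'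
    · exact absurd ⟨G.line_symm _ _ h', hsolid⟩ (G.not_line_solid _ _)
    · exact absurd ⟨h', hsolid⟩ (G.not_solid_solid _ _)

lemma preOpen_of_isColliderSection {ρ : G.skeleton.Walk x y}
    (hρ : IsColliderSection ρ 1 (ρ.length - 1))
    (hZ : ∃ k, 0 < k ∧ k < ρ.length ∧ ρ.getVert k ∈ Z) : PreOpen Z ρ := by
  have hmem : ∀ {k}, 0 < k → k < ρ.length → 1 ≤ k ∧ k ≤ ρ.length - 1 := fun h0 hk => by omega
  refine ⟨fun k hc => ?_, fun s t hst => ?_, fun k h0 hk _ hs => ?_⟩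
  · exact absurd hc (hρ.not_isColliderNode (hmem hc.1 hc.2.1).1 (hmem hc.1 hc.2.1).2)
  · obtain ⟨-, -, -, -, hline, -⟩ := hρ
    obtain ⟨h0, hst, ht, hs, -, ht'⟩ := hst
    obtain rfl : s = 1 := by
      by_contra hne
      have hl := hline (s - 1) (by omega) (by omega)
      rw [Nat.sub_add_cancel h0] at hl
      exact G.not_line_solid _ _ ⟨hl, hs⟩
    obtain rfl : t = ρ.length - 1 := by
      by_contra hne
      exact G.not_line_solid _ _ ⟨G.line_symm _ _ (hline t (by omega) (by omega)), ht'⟩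
    obtain ⟨k, h0, hk, hkZ⟩ := hZ
    exact ⟨k, h0, by omega, hkZ⟩
  · exact absurd ⟨_, _, hρ, hmem h0 hk⟩ hs

lemma IsUndirected.isColliderSection {ρ : G.skeleton.Walk x y} (hρ : IsUndirected ρ)
    (hf : G.solid f x) (hf' : G.solid f' y) :
    IsColliderSection (.cons (skeleton_adj_of_arrow (Or.inl hf)) (ρ.append
      (.cons (skeleton_adj_of_arrow (Or.inl hf')).symm .nil))) 1 (ρ.length + 1) := by
  refine ⟨one_pos, by omega, by simp, by simpa using hf, ?_, ?_⟩
  · rintro (- | k) h0 hk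
    · omega
    · rw [SimpleGraph.Walk.getVert_cons_succ, SimpleGraph.Walk.getVert_cons_succ,
        getVert_append_left _ _ (by omega), getVert_append_left _ _ (by omega)]
      exact hρ k (by omega)
  · rw [SimpleGraph.Walk.getVert_cons_succ, SimpleGraph.Walk.getVert_cons_succ,
      getVert_append_right, getVert_append_left _ _ le_rfl, SimpleGraph.Walk.getVert_length]
    simpa using hf'

namespace OpenVia

lemma of_adj {m n : Mark} (h : G.skeleton.Adj x y) (hm : m.At G y x) (hn : n.At G x y) :
    G.OpenVia Z m x y n := by
  have hlen : (SimpleGraph.Walk.cons h .nil).length = 1 := rfl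
  refine ⟨.cons h .nil, Nat.one_pos, ⟨fun k ⟨h0, hk, _⟩ => ?_, fun s t ⟨h0, hst, ht, _⟩ => ?_,
    fun k h0 hk => ?_⟩, hm, hn⟩ <;> omega

lemma of_solid (h : G.solid x y) : G.OpenVia Z .tail x y .solid :=
  .of_adj (skeleton_adj_of_arrow (Or.inl h)) (Or.inl h) h

lemma of_dashed (h : G.dashed x y) : G.OpenVia Z .tail x y .dashed :=
  .of_adj (skeleton_adj_of_arrow (Or.inr h)) (Or.inr h) h

lemma of_linkedOff (h : G.LinkedOff Z x y) (h' : G.line y z) : G.OpenVia Z .line x z .line := by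
  obtain ⟨ρ, h0, hρ, hZ⟩ := h.exists_isUndirected h'
  refine ⟨ρ, h0, preOpen_of_forall_line_or_solid (fun k hk => Or.inl (hρ k hk)) hZ, ?_, ?_⟩
  · have hl := hρ 0 h0
    rw [SimpleGraph.Walk.getVert_zero] at hl
    exact G.line_symm _ _ hl
  · have hl := hρ (ρ.length - 1) (by omega)
    rwa [Nat.sub_add_cancel h0, SimpleGraph.Walk.getVert_length] at hl

lemma of_solid_linkedOff (hf : G.solid f x) (hx : x ∉ Z) (h : G.LinkedOff Z x y)
    (h' : G.line y z) : G.OpenVia Z .tail f z .line := by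
  obtain ⟨ρ, h0, hρ, hZ⟩ := h.exists_isUndirected h'
  have hfx := skeleton_adj_of_arrow (Or.inl hf)
  refine ⟨.cons hfx ρ, Nat.succ_pos _,
    preOpen_of_forall_line_or_solid ?_ (getVert_cons_notMem hfx hx hZ), ?_, ?_⟩
  · rintro (- | k) hk
    · exact Or.inr (by simpa using hf)
    · exact Or.inl (by simpa using hρ k (by simpa using hk))
  · rw [SimpleGraph.Walk.getVert_cons_succ, SimpleGraph.Walk.getVert_zero]
    exact Or.inl hf
  · have hl := hρ (ρ.length - 1) (by omega)
    rwa [Nat.sub_add_cancel h0, SimpleGraph.Walk.getVert_length,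
      ← SimpleGraph.Walk.getVert_cons_succ ρ hfx, Nat.sub_add_cancel h0] at hl

lemma of_solid_solid (hf : G.solid f x) (hf' : G.solid f' y) (hz : z ∈ Z) (hxz : G.Linked x z)
    (hzy : G.Linked z y) : G.OpenVia Z .tail f f' .tail := by
  obtain ⟨ρ₁, hρ₁⟩ := hxz.exists_isUndirected
  obtain ⟨ρ₂, hρ₂⟩ := hzy.exists_isUndirected
  have hsec := (hρ₁.append hρ₂).isColliderSection hf hf'
  have hvert : (ρ₁.append ρ₂).getVert ρ₁.length = z := by
    rw [getVert_append_left _ _ le_rfl, SimpleGraph.Walk.getVert_length]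
  have hle : ρ₁.length ≤ (ρ₁.append ρ₂).length := by
    rw [SimpleGraph.Walk.length_append]
    omega
  generalize ρ₁.append ρ₂ = ρ at hsec hvert hle
  refine ⟨.cons (skeleton_adj_of_arrow (Or.inl hf)) (ρ.append
    (.cons (skeleton_adj_of_arrow (Or.inl hf')).symm .nil)), by simp,
    preOpen_of_isColliderSection (by simpa using hsec) ⟨ρ₁.length + 1, by omega, ?_, ?_⟩, ?_, ?_⟩
  · simpa using hle.trans_lt (Nat.lt_succ_self _)
  · rwa [SimpleGraph.Walk.getVert_cons_succ, getVert_append_left _ _ hle, hvert]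
  · rw [SimpleGraph.Walk.getVert_cons_succ, SimpleGraph.Walk.getVert_zero]
    exact Or.inl hf
  · have hlen : (SimpleGraph.Walk.cons (skeleton_adj_of_arrow (Or.inl hf)) (ρ.append
        (.cons (skeleton_adj_of_arrow (Or.inl hf')).symm .nil))).length - 1 = ρ.length + 1 := by
      simp
    rw [hlen, SimpleGraph.Walk.getVert_cons_succ, getVert_append_left _ _ le_rfl,
      SimpleGraph.Walk.getVert_length]
    exact Or.inl hf'

end OpenVia

end MixedGraph

/-! ### From separation by routes to the global Markov property -/

namespace MixedGraph

variable {V : Type*} {G : MixedGraph V} {Z : Set V} {a b f i j k l x y z : V}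
  {m m' n n' : Mark}

namespace OpenVia

lemma join_of_notMem (h : G.OpenVia Z m x y n) (h' : G.OpenVia Z m' y z n') (hy : y ∉ Z)
    (ht : n = .tail ∨ m' = .tail) : G.OpenVia Z m x z n' :=
  h.join h' (Or.inl ⟨hy, ht⟩)

lemma join_of_dashed_left (h : G.OpenVia Z m x y .dashed) (h' : G.OpenVia Z m' y z n')
    (hy : y ∈ Z) (hm' : m' ≠ .tail) : G.OpenVia Z m x z n' :=
  h.join h' (Or.inr ⟨hy, by simp, hm', Or.inl rfl⟩)

lemma join_of_dashed_right (h : G.OpenVia Z m x y n) (h' : G.OpenVia Z .dashed y z n')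
    (hy : y ∈ Z) (hn : n ≠ .tail) : G.OpenVia Z m x z n' :=
  h.join h' (Or.inr ⟨hy, hn, by simp, Or.inr rfl⟩)

lemma exists_of_solid_linkedOff (hf : G.solid f x) (hx : x ∉ Z) (h : G.LinkedOff Z x y) :
    ∃ n, G.OpenVia Z .tail f y n := by
  cases h with
  | refl => exact ⟨_, .of_solid hf⟩
  | tail h hl => exact ⟨_, .of_solid_linkedOff hf hx h hl.1⟩

end OpenVia

/-- There is a route from `i` to `a` with `Z`-open interior that is trivial or has a tail
at `i`. -/
def ExitsTo (G : MixedGraph V) (Z : Set V) (i a : V) : Prop :=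
  i = a ∨ ∃ n, G.OpenVia Z .tail i a n

lemma OpenVia.exitsTo (e : G.OpenVia Z .tail i j n) (hj : j ∉ Z) (h : G.ExitsTo Z j a) :
    G.ExitsTo Z i a := by
  rcases h with rfl | ⟨m, h⟩
  · exact Or.inr ⟨n, e⟩
  · exact Or.inr ⟨m, e.join_of_notMem h hj (Or.inr rfl)⟩

lemma OpenVia.returns_or_exitsTo (e : G.OpenVia Z .tail i j n) (hj : j ∉ Z)
    (h : G.OpenVia Z .tail j j .tail ∨ G.ExitsTo Z j a ∨ G.ExitsTo Z j b) :
    G.OpenVia Z .tail i i .tail ∨ G.ExitsTo Z i a ∨ G.ExitsTo Z i b :=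
  h.imp (fun h => (e.join_of_notMem h hj (Or.inr rfl)).join_of_notMem e.symm hj (Or.inl rfl))
    (Or.imp (e.exitsTo hj) (e.exitsTo hj))

/-- The nodes that are in `Z`, or equal to `a` or `b`, or from which one of these can be reached by
routes of dashed edges and of solid edges followed by undirected edges. -/
inductive Relevant (G : MixedGraph V) (Z : Set V) (a b : V) : V → Prop
  | obs (z : V) : z ∈ Z → Relevant G Z a b z
  | left : Relevant G Z a b a
  | right : Relevant G Z a b b
  | dashed (i j : V) : G.dashed i j → Relevant G Z a b j → Relevant G Z a b i
  | solid (i j k : V) : G.solid i j → G.Linked j k → Relevant G Z a b k → Relevant G Z a b i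

lemma Relevant.returns_or_exitsTo (h : G.Relevant Z a b i) (hi : i ∉ Z) :
    G.OpenVia Z .tail i i .tail ∨ G.ExitsTo Z i a ∨ G.ExitsTo Z i b := by
  induction h with
  | obs z hz => exact absurd hz hi
  | left => exact Or.inr (Or.inl (Or.inl rfl))
  | right => exact Or.inr (Or.inr (Or.inl rfl))
  | dashed i j hd _ ih =>
    have e : G.OpenVia Z .tail i j .dashed := .of_dashed hd
    by_cases hj : j ∈ Z
    · exact Or.inl (e.join_of_dashed_left e.symm hj (by simp))
    · exact e.returns_or_exitsTo hj (ih hj)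
  | solid i j k hs hl _ ih =>
    by_cases hz : ∃ z ∈ Z, G.Linked j z
    · obtain ⟨z, hz, hjz⟩ := hz
      exact Or.inl (.of_solid_solid hs hs hz hjz hjz.symm)
    · push Not at hz
      have hk : k ∉ Z := fun h => hz k h hl
      obtain ⟨n, e⟩ := OpenVia.exists_of_solid_linkedOff hs (fun h => hz j h (.refl j))
        (hl.linkedOff hz)
      exact e.returns_or_exitsTo hk (ih hk)

/-- `i` is the end of a `Z`-open route from `a` that is trivial or has a tail at `i`. -/
def TailReach (G : MixedGraph V) (Z : Set V) (a i : V) : Prop := i ∉ Z ∧ G.ExitsTo Z i a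

lemma TailReach.extend (h : G.TailReach Z a i) (h' : G.OpenVia Z m i j n) :
    ∃ m, G.OpenVia Z m a j n := by
  obtain ⟨hi, rfl | ⟨p, hp⟩⟩ := h
  · exact ⟨m, h'⟩
  · exact ⟨p, hp.symm.join_of_notMem h' hi (Or.inl rfl)⟩

lemma TailReach.extend_tail (h : G.TailReach Z a i) (h' : G.OpenVia Z m i j .tail) (hj : j ∉ Z) :
    G.TailReach Z a j :=
  ⟨hj, Or.inr ((h.extend h').imp fun _ e => e.symm)⟩

/-- The node `s` can be the first one of an undirected part of an open route from `a`. -/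
def Start (G : MixedGraph V) (Z : Set V) (a s : V) : Prop :=
  (s ∉ Z ∧ (G.TailReach Z a s ∨ ∃ f, G.solid f s ∧ G.TailReach Z a f)) ∨
    (s ∈ Z ∧ ∃ m, G.dashed m s ∧ G.TailReach Z a m)

/-- The node `i` can be on an open route from `a`. -/
def Live (G : MixedGraph V) (Z : Set V) (a i : V) : Prop :=
  ∃ s, G.Start Z a s ∧ G.LinkedOff Z s i

/-- An open route from `a` can be continued by a solid edge into the chain component of `i`. -/
def LiveComp (G : MixedGraph V) (Z : Set V) (a i : V) : Prop :=
  ∃ f s, G.TailReach Z a f ∧ G.solid f s ∧ G.Linked s i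

lemma Start.live (h : G.Start Z a i) : G.Live Z a i := ⟨i, h, .refl⟩

lemma TailReach.live (h : G.TailReach Z a i) : G.Live Z a i :=
  Start.live (Or.inl ⟨h.1, Or.inl h⟩)

lemma LiveComp.of_linked (h : G.LiveComp Z a i) (hl : G.Linked i j) : G.LiveComp Z a j := by
  obtain ⟨f, s, hf, hs, hsi⟩ := h
  exact ⟨f, s, hf, hs, hsi.trans hl⟩

lemma exists_dashed_notMem_of_notMem_barrier (hi : i ∈ Z) (hb : i ∉ G.barrier Z) :
    ∃ l, G.dashed l i ∧ l ∉ Z := by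
  by_contra! h
  exact hb ⟨hi, h⟩

namespace Live

lemma exists_openVia_line (h : G.Live Z a i) (hij : G.line i j) :
    ∃ m, G.OpenVia Z m a j .line := by
  obtain ⟨s, ⟨hs, ha | ⟨f, hf, ha⟩⟩ | ⟨hs, l, hd, ha⟩, hsi⟩ := h
  · exact ha.extend (.of_linkedOff hsi hij)
  · exact ha.extend (.of_solid_linkedOff hf hs hsi hij)
  · exact ha.extend ((OpenVia.of_dashed hd).join_of_dashed_left (.of_linkedOff hsi hij) hs
      (by simp))

lemma eq_or_exists_openVia (h : G.Live Z a i) (hi : i ∉ Z) :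
    i = a ∨ ∃ m n, G.OpenVia Z m a i n := by
  obtain ⟨s, hs, h⟩ := h
  cases h with
  | refl =>
    rcases hs with ⟨-, ha | ⟨f, hf, ha⟩⟩ | ⟨hs, -⟩
    · exact ha.2.imp_right fun ⟨n, e⟩ => ⟨n, _, e.symm⟩
    · obtain ⟨m, e⟩ := ha.extend (OpenVia.of_solid hf)
      exact Or.inr ⟨m, _, e⟩
    · exact absurd hs hi
  | tail h hl =>
    obtain ⟨m, e⟩ := exists_openVia_line ⟨s, hs, h⟩ hl.1
    exact Or.inr ⟨m, _, e⟩

lemma exists_dashed_of_mem (h : G.Live Z a i) (hi : i ∈ Z) :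
    ∃ l, G.dashed l i ∧ G.TailReach Z a l := by
  obtain ⟨s, hs, h⟩ := h
  cases h with
  | refl =>
    rcases hs with hs | hs
    · exact absurd hi hs.1
    · exact hs.2
  | tail _ hl => exact absurd hi hl.2

lemma of_line (h : G.Live Z a i) (hij : G.line i j) (hj : j ∉ G.barrier Z) : G.Live Z a j := by
  by_cases hjZ : j ∈ Z
  · obtain ⟨l, hd, hl⟩ := exists_dashed_notMem_of_notMem_barrier hjZ hj
    obtain ⟨m, e⟩ := h.exists_openVia_line hij
    have e' := e.join_of_dashed_right (OpenVia.of_dashed hd).symm hjZ (by simp)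
    exact Start.live (Or.inr ⟨hjZ, l, hd, hl, Or.inr ⟨m, e'.symm⟩⟩)
  · obtain ⟨s, hs, h⟩ := h
    exact ⟨s, hs, h.tail ⟨hij, hjZ⟩⟩

end Live

/-- No route from `a` to `b` has a `Z`-open interior. -/
def NoOpenVia (G : MixedGraph V) (Z : Set V) (a b : V) : Prop := ∀ m n, ¬ G.OpenVia Z m a b n

namespace NoOpenVia

lemma tailReach (hsep : G.NoOpenVia Z a b) (hi : i ∉ Z) (h : i = a ∨ ∃ m n, G.OpenVia Z m a i n)
    (hr : G.Relevant Z a b i) : G.TailReach Z a i := by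
  refine ⟨hi, ?_⟩
  rcases h with h | ⟨m, n, h⟩
  · exact Or.inl h
  rcases hr.returns_or_exitsTo hi with h' | h' | rfl | ⟨p, h'⟩
  · exact Or.inr ⟨m, (h.join_of_notMem h' hi (Or.inr rfl)).symm⟩
  · exact h'
  · exact absurd h (hsep m n)
  · exact absurd (h.join_of_notMem h' hi (Or.inr rfl)) (hsep m p)

lemma tailReach_of_live (hsep : G.NoOpenVia Z a b) (hi : i ∉ Z) (h : G.Live Z a i)
    (hr : G.Relevant Z a b i) : G.TailReach Z a i :=
  hsep.tailReach hi (h.eq_or_exists_openVia hi) hr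

lemma live_dashed_iff (hsep : G.NoOpenVia Z a b) (hd : G.dashed l i) (hl : l ∉ Z)
    (hi : G.Relevant Z a b i) : G.Live Z a l ↔ G.Live Z a i := by
  constructor
  · intro h
    have hal := hsep.tailReach_of_live hl h (.dashed l i hd hi)
    by_cases hiZ : i ∈ Z
    · exact Start.live (Or.inr ⟨hiZ, l, hd, hal⟩)
    · obtain ⟨m, e⟩ := hal.extend (OpenVia.of_dashed hd)
      exact (hsep.tailReach hiZ (Or.inr ⟨m, _, e⟩) hi).live
  · intro h
    by_cases hiZ : i ∈ Z
    · obtain ⟨l', hd', hal'⟩ := h.exists_dashed_of_mem hiZ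
      exact (hal'.extend_tail ((OpenVia.of_dashed hd').join_of_dashed_left
        (OpenVia.of_dashed hd).symm hiZ (by simp)) hl).live
    · exact ((hsep.tailReach_of_live hiZ h hi).extend_tail (OpenVia.of_dashed hd).symm hl).live

/-- If the chain component meets `Z`, the two solid edges bound an open collider section. Otherwise
the route can be continued to the relevant node `k` and then back to `f`. -/
lemma tailReach_of_liveComp (hsep : G.NoOpenVia Z a b) (h : G.LiveComp Z a i) (hf : G.solid f i)
    (hfZ : f ∉ Z) (hik : G.Linked i k) (hk : G.Relevant Z a b k) : G.TailReach Z a f := by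
  obtain ⟨f', s, hf', hs, hsi⟩ := h
  by_cases hz : ∃ z ∈ Z, G.Linked s z
  · obtain ⟨z, hz, hsz⟩ := hz
    exact hf'.extend_tail (.of_solid_solid hs hf hz hsz (hsz.symm.trans hsi)) hfZ
  · push Not at hz
    have hz' : ∀ z ∈ Z, ¬ G.Linked i z := fun z h h' => hz z h (hsi.trans h')
    obtain ⟨n, e⟩ := OpenVia.exists_of_solid_linkedOff hs (fun h => hz s h (.refl s))
      ((hsi.trans hik).linkedOff hz)
    obtain ⟨m, e'⟩ := hf'.extend e
    have hak := hsep.tailReach (fun h => hz' k h hik) (Or.inr ⟨m, n, e'⟩) hk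
    obtain ⟨n', e''⟩ := OpenVia.exists_of_solid_linkedOff hf (fun h => hz' i h (.refl i))
      (hik.linkedOff hz')
    exact hak.extend_tail e''.symm hfZ

lemma tailReach_of_live_solid (hsep : G.NoOpenVia Z a b) (h : G.Live Z a i) (hf : G.solid f i)
    (hfZ : f ∉ Z) (hik : G.Linked i k) (hk : G.Relevant Z a b k) : G.TailReach Z a f := by
  by_cases hi : i ∈ Z
  · obtain ⟨l, hd, hal⟩ := h.exists_dashed_of_mem hi
    exact hal.extend_tail ((OpenVia.of_dashed hd).join_of_dashed_left (OpenVia.of_solid hf).symm hi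
      (by simp)) hfZ
  obtain ⟨s, ⟨hs, ha | ⟨f', hf', ha⟩⟩ | ⟨hs, l, hd, ha⟩, hsi⟩ := h
  · obtain ⟨n, e⟩ := OpenVia.exists_of_solid_linkedOff hf hi (hsi.symm hs)
    exact ha.extend_tail e.symm hfZ
  · exact hsep.tailReach_of_liveComp ⟨f', s, ha, hf', hsi.linked⟩ hf hfZ hik hk
  · rcases Relation.ReflTransGen.cases_head hsi with rfl | ⟨s', ⟨hl, hs'⟩, hs'i⟩
    · exact absurd hs hi
    · have e : G.OpenVia Z .tail f s .line :=
        .of_solid_linkedOff hf hi (LinkedOff.symm hs'i hs') (G.line_symm _ _ hl)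
      exact ha.extend_tail ((OpenVia.of_dashed hd).join_of_dashed_left e.symm hs (by simp)) hfZ

lemma live_solid_iff (hsep : G.NoOpenVia Z a b) (hf : G.solid f i) (hfZ : f ∉ Z)
    (hik : G.Linked i k) (hk : G.Relevant Z a b k) (hi : i ∉ G.barrier Z) :
    G.Live Z a f ↔ G.Live Z a i := by
  refine ⟨fun h => ?_, fun h => (hsep.tailReach_of_live_solid h hf hfZ hik hk).live⟩
  have haf := hsep.tailReach_of_live hfZ h (.solid f i k hf hik hk)
  by_cases hiZ : i ∈ Z
  · obtain ⟨l, hd, hl⟩ := exists_dashed_notMem_of_notMem_barrier hiZ hi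
    have e : G.OpenVia Z .tail f l .tail :=
      (OpenVia.of_solid hf).join_of_dashed_right (OpenVia.of_dashed hd).symm hiZ (by simp)
    exact Start.live (Or.inr ⟨hiZ, l, hd, haf.extend_tail e hl⟩)
  · exact Start.live (Or.inl ⟨hiZ, Or.inr ⟨f, hf, haf⟩⟩)

lemma live_iff_liveComp (hsep : G.NoOpenVia Z a b) (hf : G.solid f i) (hfZ : f ∉ Z)
    (hik : G.Linked i k) (hk : G.Relevant Z a b k) : G.Live Z a f ↔ G.LiveComp Z a i :=
  ⟨fun h => ⟨f, i, hsep.tailReach_of_live hfZ h (.solid f i k hf hik hk), hf, .refl i⟩,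
    fun h => (hsep.tailReach_of_liveComp h hf hfZ hik hk).live⟩

lemma isSeparation (hsep : G.NoOpenVia Z a b) (ha : a ∉ Z) (hb : b ∉ Z) (hab : a ≠ b) :
    G.IsSeparation Z a b {i | G.Relevant Z a b i} {i | G.Live Z a i} {i | G.LiveComp Z a i} where
  left_mem := ⟨.left, TailReach.live ⟨ha, Or.inl rfl⟩⟩
  right_mem := ⟨.right, fun h => (h.eq_or_exists_openVia hb).elim hab.symm
    fun ⟨m, n, e⟩ => hsep m n e⟩
  subset := .obs
  mem_of_dashed := .dashed
  mem_of_solid := fun i j hs ⟨k, hk, hjk⟩ => .solid i j k hs hjk hk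
  iff_of_dashed := fun _ _ hd hl hi => hsep.live_dashed_iff hd hl hi
  iff_of_line := fun _ _ h hi hj =>
    ⟨fun h' => h'.of_line h hj, fun h' => h'.of_line (G.line_symm _ _ h) hi⟩
  iff_of_solid := fun _ _ hf hfZ ⟨_, hk, hik⟩ hi => hsep.live_solid_iff hf hfZ hik hk hi
  comp_iff_of_line := fun _ _ h =>
    ⟨fun h' => h'.of_linked (.of_line h), fun h' => h'.of_linked (Linked.of_line h).symm⟩
  comp_iff_of_solid := fun _ _ hf hfZ ⟨_, hk, hik⟩ => hsep.live_iff_liveComp hf hfZ hik hk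

end NoOpenVia

lemma Separated.noOpenVia {X Y : Set V} (h : G.Separated X Y Z) (ha : a ∈ X) (hb : b ∈ Y)
    (haZ : a ∉ Z) (hbZ : b ∉ Z) : G.NoOpenVia Z a b := by
  rintro m n ⟨ρ, -, hρ, -, -⟩
  exact h a ha b hb ρ (hρ.isOpenRoute haZ hbZ)

lemma Factorization.globalMarkov [Fintype V] (hG : G.IsChainGraph) {p : Measure (V → ℝ)}
    [IsGaussian p] (hp : (covMatrix p).PosDef) {W B F : Matrix V V ℝ}
    (hf : G.Factorization (covMatrix p) W B F) : G.GlobalMarkov p := by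
  intro X Y Z hXY hXZ hYZ hsep
  refine condIndepCoords_of_isResidual fun a ha => ?_
  have haZ := Set.disjoint_left.1 hXZ ha
  obtain ⟨γ, hγ⟩ := exists_isResidual hp haZ
  refine ⟨γ, hγ, fun b hb => ?_⟩
  have hbZ := Set.disjoint_left.1 hYZ hb
  have hab : a ≠ b := fun h => Set.disjoint_left.1 hXY ha (h ▸ hb)
  exact hf.mulVec_eq_zero_of_isSeparation hG
    ((hsep.noOpenVia ha hb haZ hbZ).isSeparation haZ hbZ hab) hγ

end MixedGraph

/-! ### From the global to the pairwise Markov property -/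

namespace MixedGraph

variable {V : Type*} {G : MixedGraph V} {Z : Set V}

section FirstAndLast

variable {P : ℕ → Prop} {k l : ℕ}

lemma exists_forall_not_and_succ (hkl : k ≤ l) (hk : ¬ P k) (hl : P l) :
    ∃ n, k ≤ n ∧ n < l ∧ (∀ r, k ≤ r → r ≤ n → ¬ P r) ∧ P (n + 1) := by
  induction hkl using Nat.decreasingInduction with
  | self => exact absurd hl hk
  | of_succ k hkl ih =>
    by_cases hk' : P (k + 1)
    · exact ⟨k, le_rfl, hkl, fun r hkr hrk => by rwa [le_antisymm hrk hkr], hk'⟩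
    · obtain ⟨n, hkn, hnl, hn, hn'⟩ := ih hk'
      refine ⟨n, by omega, hnl, fun r hkr hrn => ?_, hn'⟩
      rcases hkr.eq_or_lt with rfl | hkr
      · exact hk
      · exact hn r hkr hrn

lemma exists_and_forall_not (hkl : k ≤ l) (hk : P k) (hl : ¬ P l) :
    ∃ n, k ≤ n ∧ n < l ∧ P n ∧ ∀ r, n < r → r ≤ l → ¬ P r := by
  induction l, hkl using Nat.le_induction with
  | base => exact absurd hk hl
  | succ l hkl ih =>
    by_cases hl' : P l
    · exact ⟨l, hkl, l.lt_succ_self, hl', fun r hlr hrl => by rwa [le_antisymm hrl hlr]⟩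
    · obtain ⟨n, hkn, hnl, hn, hn'⟩ := ih hl'
      refine ⟨n, hkn, by omega, hn, fun r hnr hrl => ?_⟩
      rcases hrl.eq_or_lt with rfl | hrl
      · exact hl
      · exact hn' r hnr (Nat.lt_succ_iff.1 hrl)

end FirstAndLast

section Routes

variable {x y : V}

lemma exists_mark_at_of_arrow (h : G.Arrow x y) : ∃ m : Mark, m.At G x y ∧ m ≠ .tail := by
  rcases h with h | h
  · exact ⟨.solid, h, by simp⟩
  · exact ⟨.dashed, h, by simp⟩

lemma not_arrow_of_arrow (h : G.Arrow x y) : ¬ G.Arrow y x := fun h' => by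
  obtain ⟨m, hm, hm'⟩ := exists_mark_at_of_arrow h
  exact hm' (hm.tail_eq h')

variable {ρ : G.skeleton.Walk x y} {k l m : ℕ}

lemma linked_getVert (h : ∀ r, k ≤ r → r < l → G.line (ρ.getVert r) (ρ.getVert (r + 1)))
    (hkl : k ≤ l) : G.Linked (ρ.getVert k) (ρ.getVert l) :=
  (reflTransGen_of_succ_of_le (fun r s => G.line (ρ.getVert r) (ρ.getVert s))
    (fun r hr => h r hr.1 hr.2) hkl).lift ρ.getVert fun _ _ => id

lemma steps_getVert (h : ∀ r, k ≤ r → r < l → G.Step (ρ.getVert (r + 1)) (ρ.getVert r))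
    (hkl : k ≤ l) : Relation.ReflTransGen G.Step (ρ.getVert l) (ρ.getVert k) :=
  (reflTransGen_of_succ_of_ge (fun r s => G.Step (ρ.getVert r) (ρ.getVert s))
    (fun r hr => h r hr.1 hr.2) hkl).lift ρ.getVert fun _ _ => id

namespace IsOpenRoute

lemma notMem_of_arrow_succ (h : IsOpenRoute Z ρ) (hk : k < ρ.length)
    (ha : G.Arrow (ρ.getVert k) (ρ.getVert (k + 1))) : ρ.getVert k ∉ Z := by
  refine h.other k hk.le (fun hc => ?_) ?_
  · obtain ⟨m, n, hm, hn⟩ := exists_marks_at hc.1 hk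
    exact ((isColliderNode_iff_of_at hc.1 hk hm hn).1 hc).2.1 (hn.tail_eq ha)
  · rintro ⟨s, t, hst, hsk, hkt⟩
    simpa using hst.at_next (m := .tail) hsk hkt ha

lemma notMem_of_arrow_pred (h : IsOpenRoute Z ρ) (hk : k < ρ.length)
    (ha : G.Arrow (ρ.getVert (k + 1)) (ρ.getVert k)) : ρ.getVert (k + 1) ∉ Z := by
  refine h.other (k + 1) hk (fun hc => ?_) ?_
  · obtain ⟨m, n, hm, hn⟩ := exists_marks_at hc.1 hc.2.1
    exact ((isColliderNode_iff_of_at hc.1 hc.2.1 hm hn).1 hc).1 (hm.tail_eq ha)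
  · rintro ⟨s, t, hst, hsk, hkt⟩
    simpa using hst.at_prev (m := .tail) hsk hkt ha

lemma exists_mem_of_arrow_line_arrow (h : IsOpenRoute Z ρ) (hkl : k < l) (hl : l < ρ.length)
    (hk' : G.Arrow (ρ.getVert k) (ρ.getVert (k + 1)))
    (hline : ∀ r, k < r → r < l → G.line (ρ.getVert r) (ρ.getVert (r + 1)))
    (hl' : G.Arrow (ρ.getVert (l + 1)) (ρ.getVert l)) :
    ∃ r, k < r ∧ r ≤ l ∧ ρ.getVert r ∈ Z := by
  have hnext : ∃ n : Mark, n.At G (ρ.getVert (k + 1 + 1)) (ρ.getVert (k + 1)) ∧ n ≠ .tail := by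
    rcases (Nat.succ_le_of_lt hkl).eq_or_lt with rfl | hlt
    · exact exists_mark_at_of_arrow hl'
    · exact ⟨.line, G.line_symm _ _ (hline (k + 1) k.lt_succ_self hlt), by simp⟩
  have hprev : ∃ m : Mark, m.At G (ρ.getVert (l - 1)) (ρ.getVert l) ∧ m ≠ .tail := by
    obtain ⟨l, rfl⟩ := Nat.exists_eq_succ_of_ne_zero (by omega : l ≠ 0)
    rcases (Nat.lt_succ_iff.1 hkl).eq_or_lt with rfl | hlt
    · exact exists_mark_at_of_arrow hk'
    · exact ⟨.line, hline l hlt l.lt_succ_self, by simp⟩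
  rcases hk' with hk' | hk'
  · rcases hl' with hl' | hl'
    · obtain ⟨r, hr, hr', hrZ⟩ := h.collider_section (k + 1) l
        ⟨k.succ_pos, hkl, hl, hk', fun r hr hr' => hline r hr hr', hl'⟩
      exact ⟨r, hr, hr', hrZ⟩
    · obtain ⟨m, hm, hm'⟩ := hprev
      exact ⟨l, hkl, le_rfl, h.collider_node l
        ((isColliderNode_iff_of_at (n := .dashed) (by omega) hl hm hl').2 (by simp [hm']))⟩
  · obtain ⟨n, hn, hn'⟩ := hnext
    exact ⟨k + 1, k.lt_succ_self, hkl, h.collider_node (k + 1)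
      ((isColliderNode_iff_of_at (m := .dashed) k.succ_pos (by omega) hk' hn).2 (by simp [hn']))⟩

/-- The last forward arrow before the first backward arrow bounds an undirected part of the
route. -/
lemma exists_mem_of_arrows (h : IsOpenRoute Z ρ) (hkl : k < l) (hl : l < ρ.length)
    (hk' : G.Arrow (ρ.getVert k) (ρ.getVert (k + 1)))
    (hl' : G.Arrow (ρ.getVert (l + 1)) (ρ.getVert l)) :
    ∃ r, k < r ∧ r ≤ l ∧ ρ.getVert r ∈ Z := by
  obtain ⟨t, hkt, htl, hback, ht⟩ := exists_forall_not_and_succ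
    (P := fun r => G.Arrow (ρ.getVert (r + 1)) (ρ.getVert r)) hkl.le (not_arrow_of_arrow hk') hl'
  obtain ⟨s, hks, hst, hs, hforw⟩ := exists_and_forall_not
    (P := fun r => G.Arrow (ρ.getVert r) (ρ.getVert (r + 1))) (Nat.le_succ_of_le hkt) hk'
    (not_arrow_of_arrow ht)
  have hline : ∀ r, s < r → r < t + 1 → G.line (ρ.getVert r) (ρ.getVert (r + 1)) :=
    fun r hsr hrt => ((arrow_or_line_or_arrow_of_adj (ρ.adj_getVert_succ (by omega))).resolve_left
      (hforw r hsr hrt.le)).resolve_right (hback r (by omega) (by omega))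
  obtain ⟨r, hsr, hrt, hrZ⟩ := h.exists_mem_of_arrow_line_arrow hst (by omega) hs hline ht
  exact ⟨r, by omega, by omega, hrZ⟩

lemma notMem_of_line (h : IsOpenRoute Z ρ) (hm : m + 1 < ρ.length)
    (hl : G.line (ρ.getVert m) (ρ.getVert (m + 1))) (hMo : G.Mo (G.comp (ρ.getVert m)) ⊆ Z)
    (hFa : ∀ k ≤ m, ρ.getVert k ∈ G.Fa (G.comp (ρ.getVert m)) → ρ.getVert k ∈ Z) :
    ρ.getVert (m + 1) ∉ Z := by
  refine h.other (m + 1) hm.le (fun hc => ?_) ?_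
  · obtain ⟨m', n', hm', hn'⟩ := exists_marks_at (ρ := ρ) m.succ_pos hm
    obtain ⟨-, -, hd⟩ := (isColliderNode_iff_of_at m.succ_pos hm hm' hn').1 hc
    obtain rfl := hm'.line_eq hl
    obtain rfl : n' = .dashed := by simpa using hd
    exact h.notMem_of_arrow_pred hm (Or.inr hn') (hMo ⟨_, .of_line hl, hn'⟩)
  · rintro ⟨s, t, ⟨hs0, -, _, hsolid, hline, -⟩, hsm, hmt⟩
    have hsm' : s ≤ m := by
      by_contra hsm'
      obtain rfl : s = m + 1 := by omega
      exact G.not_line_solid _ _ ⟨hl, hsolid⟩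
    have hlink : G.Linked (ρ.getVert s) (ρ.getVert m) :=
      linked_getVert (fun r hsr hrm => hline r hsr (by omega)) hsm'
    refine h.notMem_of_arrow_succ (k := s - 1) (by omega) ?_
      (hFa (s - 1) (by omega) ⟨_, hlink.symm, hsolid⟩)
    rw [Nat.sub_add_cancel hs0]
    exact Or.inl hsolid

lemma exists_mem_notMem_Nd_of_arrow (h : IsOpenRoute Z ρ) (hml : m < l) (hl : l ≤ ρ.length)
    (harr : G.Arrow (ρ.getVert m) (ρ.getVert (m + 1)))
    (hlm : ρ.getVert l ∈ G.Nd {ρ.getVert m}) :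
    ∃ k, m < k ∧ k < l ∧ ρ.getVert k ∈ Z ∧ ρ.getVert k ∉ G.Nd {ρ.getVert m} := by
  obtain ⟨n, hmn, hnl, hn, hn'⟩ := exists_forall_not_and_succ
    (P := fun r => ρ.getVert r ∈ G.Nd {ρ.getVert m}) (Nat.succ_le_of_lt hml)
    (fun h' => mem_Nd_singleton.1 h' (.of_arrow harr)) hlm
  have hdesc : G.StrictDesc (ρ.getVert m) (ρ.getVert n) :=
    not_not.1 (mt mem_Nd_singleton.2 (hn n hmn le_rfl))
  have hstep : ¬ G.Step (ρ.getVert n) (ρ.getVert (n + 1)) :=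
    fun h' => mem_Nd_singleton.1 hn' (hdesc.trans_steps (.single h'))
  have hback : G.Arrow (ρ.getVert (n + 1)) (ρ.getVert n) := by
    rcases arrow_or_line_or_arrow_of_adj (ρ.adj_getVert_succ (by omega : n < ρ.length)) with
      h' | h' | h'
    · exact absurd (Or.inl h') hstep
    · exact absurd (Or.inr h') hstep
    · exact h'
  obtain ⟨k, hmk, hkn, hkZ⟩ := h.exists_mem_of_arrows hmn (by omega) harr hback
  exact ⟨k, hmk, by omega, hkZ, hn k hmk hkn⟩

end IsOpenRoute

end Routes

lemma arrow_of_notMem_Pred {a x y : V} (h : G.skeleton.Adj x y) (hx : x ∉ G.Pred a)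
    (hy : y ∈ G.Pred a) : G.Arrow y x := by
  rcases arrow_or_line_or_arrow_of_adj h with h | h | h
  · exact absurd (mem_Pred_of_arrow_linked hy h (.refl y)) hx
  · exact absurd (mem_Pred_of_linked hy (.of_line (G.line_symm _ _ h))) hx
  · exact h

lemma mem_Nd_diff_pair {a b x : V} (hx : x ∈ G.Pred a) (hxb : x ≠ b) :
    x ∈ G.Nd {a} \ {a, b} := by
  refine ⟨hx.1, ?_⟩
  rintro (rfl | hxb')
  · exact notMem_Pred_self _ hx
  · exact hxb hxb'

namespace IsChainGraph

variable {a b i j : V}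

lemma line_of_forall_not_arrow (hG : G.IsChainGraph) {ρ : G.skeleton.Walk a b} {n r : ℕ}
    (hn : n ≤ ρ.length) (hforw : ∀ r < n, ¬ G.Arrow (ρ.getVert r) (ρ.getVert (r + 1)))
    (hpred : ρ.getVert n ∉ G.Pred a) (hr : r < n) : G.line (ρ.getVert r) (ρ.getVert (r + 1)) := by
  have hcases : ∀ r < n, G.line (ρ.getVert r) (ρ.getVert (r + 1)) ∨
      G.Arrow (ρ.getVert (r + 1)) (ρ.getVert r) := fun r hr =>
    (arrow_or_line_or_arrow_of_adj (ρ.adj_getVert_succ (by omega))).resolve_left (hforw r hr)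
  have hstep : ∀ r < n, G.Step (ρ.getVert (r + 1)) (ρ.getVert r) := fun r hr =>
    (hcases r hr).elim (fun h => Or.inr (G.line_symm _ _ h)) Or.inl
  refine (hcases r hr).resolve_right fun harr => hpred ?_
  have hra : Relation.ReflTransGen G.Step (ρ.getVert r) a := by
    simpa using steps_getVert (ρ := ρ) (fun s _ hs => hstep s (by omega)) (Nat.zero_le r)
  have hna : G.StrictDesc (ρ.getVert n) a :=
    ⟨_, _, steps_getVert (fun s _ hs => hstep s hs) hr, harr, hra⟩
  exact mem_Pred.2 ⟨fun h => hG.not_strictDesc_self a (h.trans_steps hna.steps),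
    fun h => hG.not_strictDesc_self a (hna.steps_trans h.steps)⟩

lemma separated_Pred (hG : G.IsChainGraph) (hj : j ∈ G.Pred i) (hFa : j ∉ G.Fa (G.comp i))
    (hMo : ¬ G.dashed j i) : G.Separated {i} {j} (G.Pred i \ {j}) := by
  rintro a rfl b rfl ρ hρ
  obtain ⟨n, -, hn, hnot, hpred⟩ := exists_forall_not_and_succ
    (P := fun k => ρ.getVert k ∈ G.Pred a) ρ.length.zero_le (by simpa using notMem_Pred_self a)
    (by simpa using hj)
  have harr : G.Arrow (ρ.getVert (n + 1)) (ρ.getVert n) :=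
    arrow_of_notMem_Pred (ρ.adj_getVert_succ hn) (hnot n n.zero_le le_rfl) hpred
  have hb : ρ.getVert (n + 1) = b := by
    by_contra hb
    exact hρ.notMem_of_arrow_pred hn harr ⟨hpred, hb⟩
  have hforw : ∀ r < n, ¬ G.Arrow (ρ.getVert r) (ρ.getVert (r + 1)) := fun r hr h => by
    obtain ⟨k, -, hk, hkZ⟩ := hρ.exists_mem_of_arrows hr hn h harr
    exact hnot k k.zero_le hk hkZ.1
  have hline : ∀ r < n, G.line (ρ.getVert r) (ρ.getVert (r + 1)) := fun r hr =>
    hG.line_of_forall_not_arrow hn.le hforw (hnot n n.zero_le le_rfl) hr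
  have hlink : G.Linked a (ρ.getVert n) := by
    simpa using linked_getVert (ρ := ρ) (fun r _ hr => hline r hr) n.zero_le
  rcases harr with h | h
  · rw [hb] at h
    exact hFa ⟨_, hlink, h⟩
  · rcases Nat.eq_zero_or_eq_succ_pred n with rfl | hn'
    · rw [hb, SimpleGraph.Walk.getVert_zero] at h
      exact hMo h
    · have hl := hline (n - 1) (by omega)
      rw [Nat.sub_add_cancel (by omega)] at hl
      exact hnot n n.zero_le le_rfl (hρ.collider_node n ((isColliderNode_iff_of_at (m := .line)
        (n := .dashed) (by omega) hn hl h).2 (by simp))).1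

lemma separated_Nd (hG : G.IsChainGraph) (hij : i ≠ j) (hj : j ∈ G.Nd {i})
    (hMo : j ∉ G.Mo (G.comp i)) (hadj : ¬ G.skeleton.Adj i j) :
    G.Separated {i} {j} (G.Nd {i} \ {i, j}) := by
  rintro a rfl b rfl ρ hρ
  obtain ⟨n, -, hn, hnb, hb⟩ := exists_forall_not_and_succ (P := fun k => ρ.getVert k = b)
    ρ.length.zero_le (by simpa using hij) (by simp)
  obtain ⟨m, -, hmn, hma, hna⟩ := exists_and_forall_not (P := fun k => ρ.getVert k = a)
    (n + 1).zero_le (by simp) (by rw [hb]; exact hij.symm)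
  have hadj' := ρ.adj_getVert_succ (by omega : m < ρ.length)
  have hmn' : m < n := by
    refine lt_of_le_of_ne (Nat.lt_succ_iff.1 hmn) ?_
    rintro rfl
    rw [hma, hb] at hadj'
    exact hadj hadj'
  by_cases hNd : ρ.getVert (m + 1) ∈ G.Nd {a}
  · have hZ : ρ.getVert (m + 1) ∈ G.Nd {a} \ {a, b} :=
      ⟨hNd, not_or.2 ⟨hna (m + 1) m.lt_succ_self hmn, hnb (m + 1) (Nat.zero_le _) hmn'⟩⟩
    rcases arrow_or_line_or_arrow_of_adj hadj' with h | h | h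
    · rw [hma] at h
      exact mem_Nd_singleton.1 hNd (.of_arrow h)
    · refine hρ.notMem_of_line (by omega) h (fun x hx => ?_) (fun k hk hFa => ?_) hZ
      · rw [hma] at hx
        exact mem_Nd_diff_pair (hG.Mo_comp_subset_Pred a hx) fun hxb => hMo (hxb ▸ hx)
      · rw [hma] at hFa
        exact mem_Nd_diff_pair (hG.Fa_comp_subset_Pred a hFa) (hnb k k.zero_le (by omega))
    · exact hρ.notMem_of_arrow_pred (by omega) h hZ
  · have harr : G.Arrow (ρ.getVert m) (ρ.getVert (m + 1)) := by
      rcases arrow_or_line_or_arrow_of_adj hadj' with h | h | h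
      · exact h
      · rw [hma] at h
        exact absurd (hG.comp_subset_Nd a (Linked.of_line h)) hNd
      · rw [hma] at h
        exact absurd (hG.mem_Pred_of_arrow h).1 hNd
    obtain ⟨k, -, -, hkZ, hkNd⟩ := hρ.exists_mem_notMem_Nd_of_arrow hmn hn harr
      (by rwa [hma, hb])
    rw [hma] at hkNd
    exact hkNd hkZ.1

lemma pairwiseMarkov_of_globalMarkov [Fintype V] (hG : G.IsChainGraph)
    {p : Measure (V → ℝ)} [IsFiniteMeasure p] (hp : G.GlobalMarkov p) : G.PairwiseMarkov p := by
  rw [PairwiseMarkov, forall_mem_Cc]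
  intro i j hadj
  constructor
  · rintro ⟨⟨hj, hFa⟩, hMo⟩
    have hij : i ≠ j := by
      rintro rfl
      exact notMem_Pred_self i hj
    exact hp _ _ _ (by simpa using hij)
      (Set.disjoint_singleton_left.2 fun h => notMem_Pred_self i h.1) (by simp)
      (hG.separated_Pred hj hFa (mt mem_Mo_singleton.2 hMo))
  · rintro ⟨⟨⟨hj, hji : j ≠ i⟩, -⟩, hMo⟩
    exact hp _ _ _ (by simpa using hji.symm) (by simp) (by simp)
      (hG.separated_Nd hji.symm hj hMo hadj)

end IsChainGraph

end MixedGraph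

theorem mainTheorem1 {V : Type*} [Fintype V] (G : MixedGraph V) (hG : G.IsUCG)
    (p : Measure (V → ℝ)) [IsGaussian p] (hp : (covMatrix p).PosDef) :
    List.TFAE [G.GlobalMarkov p, G.BlockRecursiveMarkov p, G.LocalMarkov p,
      G.PairwiseMarkov p] := by
  have hc := hG.isChainGraph
  obtain ⟨g, h, hr⟩ := MixedGraph.exists_isRegression G hp
  tfae_have 1 → 4 := hc.pairwiseMarkov_of_globalMarkov
  tfae_have 4 ↔ 2 := by
    rw [MixedGraph.pairwiseMarkov_iff hc hp hr, MixedGraph.blockRecursiveMarkov_iff hc hp hr]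
  tfae_have 3 ↔ 2 := by
    rw [MixedGraph.localMarkov_iff hG hp hr, MixedGraph.blockRecursiveMarkov_iff hc hp hr]
  tfae_have 2 → 1 := by
    intro h2
    obtain ⟨W, B, F, hf⟩ := MixedGraph.exists_factorization hG hp hr
      ((MixedGraph.blockRecursiveMarkov_iff hc hp hr).1 h2)
    exact hf.globalMarkov hc hp
  tfae_finish
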